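/- For $z\in(0,1)$ let $\mathrm{BEC}(z)$ be the binary erasure channel with erasure probability $z$. For a nonsingular $\ell\times\ell$ matrix $K$ over $\mathbb F_2$ and $i\in\{1,\dots,\ell\}$, let $f_{K,i}(z)$ be the erasure probability of the $i$-th bit-channel of $K$ over $W=\mathrm{BEC}(z)$, that is, of the channel $W_i$ with input $u_i\in\{0,1\}$, output $(y,v)$, where $y$ is a vector of $\ell$ outputs of $W$ and $v\in\{0,1\}^{i-1}$, and transition probabilities $$W_i(y,v\mid u_i)=\frac1{2^{\ell-1}}\sum_{u'\in\{0,1\}^{\ell-i}}W^{\ell}\bigl(y\mid (v,u_i,u')K\bigr),$$ where $W^\ell$ denotes $\ell$ independent uses of $W$ (the channel $W_i$ is again a binary erasure channel, up to relabelling its outputs). For $\alpha\in(0,1)$ put $g_\alpha(z)=z^\alpha(1-z)^\alpha$ and $$\lambda_{\alpha,K}(z)=\frac{\frac1\ell\sum_{i=1}^{\ell}g_\alpha(f_{K,i}(z))}{g_\alpha(z)},\qquad z\in(0,1).$$ Fix $\alpha\in(0,1/16)$ and let $\ell_1(\alpha)$ be the smallest integer $\ell>2$ such that $\frac{\log\ell}{\log\log\ell}\ge\frac1\alpha$,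 where $\log$ is the logarithm in base $2$. Let $\ell\ge\ell_1(\alpha)$ and let $K$ be selected uniformly at random among all nonsingular $\ell\times\ell$ matrices over $\mathbb F_2$. Then, with probability over the choice of $K$, 1. $\displaystyle \mathbb P\Bigl\{\lambda_{\alpha,K}(z)<\ell^{-\frac12+5\alpha}\ \text{ for all } z\in\bigl[\tfrac1{\ell^2},\,1-\tfrac1{\ell^2}\bigr]\Bigr\}>1-\frac1\ell;$ 2. $\displaystyle \mathbb P\Bigl\{\lambda_{\alpha,K}(z)<\ell^{-\frac12}\ \text{ for all } z\in\bigl(0,\tfrac1{\ell^2}\bigr)\cup\bigl(1-\tfrac1{\ell^2},\,1\bigr)\Bigr\}>1-\frac1\ell.$ -/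

import Mathlib

open scoped Matrix

namespace PolarKernel

/-- The transition probabilities of the binary erasure channel `BEC(z)`: `bec z x y` is the
probability of the output `y` given the input bit `x`. The output `none` is the erasure. -/
noncomputable def bec (z : ℝ) (x : ZMod 2) (y : Option (ZMod 2)) : ℝ :=
  match y with
  | none => z
  | some b => if b = x then 1 - z else 0

/-- The channel given by `n` independent uses of the channel `W`. -/
noncomputable def powerChannel {X Y : Type} (W : X → Y → ℝ) (n : ℕ)
    (x : Fin n → X) (y : Fin n → Y) : ℝ :=
  ∏ j, W (x j) (y j)

/-- The `i`-th bit-channel of the binary-input channel `W` under the kernel `K`. Its input is the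
bit `b`; its output `(y, v)` consists of the channel output `y` and of the bits `v` of `u` that
precede position `i`. The sum runs over all vectors `u = (v, b, u')`. -/
noncomputable def bitChannel {Y : Type} {l : ℕ} (W : ZMod 2 → Y → ℝ)
    (K : Matrix (Fin l) (Fin l) (ZMod 2)) (i : Fin l)
    (b : ZMod 2) (o : (Fin l → Y) × ({j : Fin l // j < i} → ZMod 2)) : ℝ :=
  1 / 2 ^ (l - 1) *
    ∑ u : Fin l → ZMod 2 with (∀ j : {j : Fin l // j < i}, u j = o.2 j) ∧ u i = b,
      powerChannel W l (u ᵥ* K) o.1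

/-- The erasure probability of a binary-input channel with finite output alphabet that is a binary
erasure channel up to the labelling and merging of its outputs: the probability of an output that
carries no information on the input, that is, which has the same probability under both inputs.
(For an erasure channel, any other output occurs under one of the two inputs only.) -/
noncomputable def erasureProb {Y : Type} [Fintype Y] (W : ZMod 2 → Y → ℝ) : ℝ :=
  ∑ y : Y with W 0 y = W 1 y, W 0 y

/-- The polarization behavior `f_{K,i}(z)` of the kernel `K`: the erasure probability of the `i`-th
bit-channel when the underlying channel is `BEC(z)`. The index `i` starts at `0` here. -/
noncomputable def polarizationBehavior {l : ℕ} (K : Matrix (Fin l) (Fin l) (ZMod 2)) (i : Fin l)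
    (z : ℝ) : ℝ :=
  erasureProb (bitChannel (bec z) K i)

/-- The polarization measure function `g_α(z) = z^α (1 - z)^α`. -/
noncomputable def polarizationMeasure (α z : ℝ) : ℝ :=
  z ^ α * (1 - z) ^ α

/-- `λ_{α,K}(z)`. -/
noncomputable def lam {l : ℕ} (α : ℝ) (K : Matrix (Fin l) (Fin l) (ZMod 2)) (z : ℝ) : ℝ :=
  (1 / (l : ℝ) * ∑ i : Fin l, polarizationMeasure α (polarizationBehavior K i z)) /
    polarizationMeasure α z

/-- The least integer `l` with `log l / log log l ≥ 1 / α`, logarithms in base `2`. The quotient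
makes sense, with a positive denominator, exactly for `l > 2`. -/
noncomputable def ellOne (α : ℝ) : ℕ :=
  sInf {l : ℕ | 2 < l ∧ 1 / α ≤ Real.logb 2 l / Real.logb 2 (Real.logb 2 l)}

/-- The minimum in the definition of `ellOne` is attained. -/
theorem ellOne_isLeast (α : ℝ) :
    IsLeast {l : ℕ | 2 < l ∧ 1 / α ≤ Real.logb 2 l / Real.logb 2 (Real.logb 2 l)} (ellOne α) := by
  have hne : {l : ℕ | 2 < l ∧
      1 / α ≤ Real.logb 2 l / Real.logb 2 (Real.logb 2 l)}.Nonempty := by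
    obtain ⟨n, hn1, hn2⟩ : ∃ n : ℕ, 2 ≤ n ∧ 1 / α ≤ (2 : ℝ) ^ n / n := by
      have h := tendsto_pow_const_div_const_pow_of_one_lt 1 (r := (2 : ℝ)) (by norm_num)
      have h2 : Filter.Tendsto (fun n : ℕ => (2 : ℝ) ^ n / n) Filter.atTop Filter.atTop := by
        have h3 : Filter.Tendsto (fun n : ℕ => (n : ℝ) ^ 1 / 2 ^ n) Filter.atTop
            (nhdsWithin 0 (Set.Ioi 0)) := by
          refine tendsto_nhdsWithin_iff.2 ⟨h, ?_⟩
          filter_upwards [Filter.eventually_gt_atTop 0] with n hn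
          have : (0 : ℝ) < n := by exact_mod_cast hn
          simp only [Set.mem_Ioi]
          positivity
        refine h3.inv_tendsto_nhdsGT_zero.congr fun n => ?_
        simp
      obtain ⟨n, hn⟩ := ((Filter.eventually_ge_atTop 2).and
        (h2.eventually_ge_atTop (1 / α))).exists
      exact ⟨n, hn⟩
    refine ⟨2 ^ 2 ^ n, ?_, ?_⟩
    · have h1 : 2 ^ 2 ≤ 2 ^ n := Nat.pow_le_pow_right (by norm_num) hn1
      have h2 : 2 ^ 2 ≤ 2 ^ 2 ^ n := Nat.pow_le_pow_right (by norm_num) (by omega)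
      omega
    · have e1 : Real.logb 2 ((2 ^ 2 ^ n : ℕ) : ℝ) = (2 : ℝ) ^ n := by
        push_cast
        rw [Real.logb_pow, Real.logb_self_eq_one (by norm_num)]
        push_cast
        ring
      have e2 : Real.logb 2 ((2 : ℝ) ^ n) = n := by
        rw [Real.logb_pow, Real.logb_self_eq_one (by norm_num)]
        ring
      rw [e1, e2]
      exact hn2
  exact ⟨Nat.sInf_mem hne, fun l hl => Nat.sInf_le hl⟩

/-- The probability of a set of kernels when the kernel is selected uniformly at random among all
`l × l` nonsingular binary matrices. -/
noncomputable def kernelProb (l : ℕ) (A : Set (Matrix.GeneralLinearGroup (Fin l) (ZMod 2))) : ℝ :=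
  ((PMF.uniformOfFintype (Matrix.GeneralLinearGroup (Fin l) (ZMod 2))).toOuterMeasure A).toReal

end PolarKernel

/-! Over BEC(z) the bit `i` is lost exactly when the erased set S admits a vector u with first
nonzero coordinate at `i` whose codeword uK vanishes off S. Hence f_{K,i}(z) is a weighted count of
such sets (`polarizationBehavior_eq`). A uniform nonsingular K sends each nonzero vector to a
uniform nonzero vector. With bits numbered from 0, a union bound shows that S erases bit `i` with
probability at most 2^(|S| - i) (`card_isErased_mul_le`). By linear duality the complement of S
fails to erase it with probability at most 2^(|S| - (l - 1 - i)) (`card_not_isErased_mul_le`).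

Markov's inequality with slack l^4, and a union bound over bits, sizes and the two kinds of count,
give the single event `IsTypical` of probability above 1 - 1/l. It concerns counts only and not z,
so both claims follow from it deterministically, for all z at once.

Put m = log₂ l and A = l^α; the choice of l gives 64 ≤ m ≤ A and A^8 ≤ √l. By a Chernoff bound, bits
further than about 3m√l from the threshold lz have f or 1 - f at most exp(-m²), and each contributes
at most 1/l. The remaining bits, about 6m√l of them, contribute at most 1 each. For z in the middle
range g_α(z) ≥ 1/(2A²), so λ ≤ 14A³/√l < A^5/√l. For z ≤ 1/l² the empty pattern erases nothing, so f
is at most linear in z: f ≤ 2lz always, and f ≤ 4l^5 2^(-m²) z once i ≥ m². The sum is then at most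
3A³z^α while g_α(z) ≥ z^α/2, so λ ≤ 6A³/l < 1/√l. Values of z near 1 are handled by the dual counts.
-/

namespace PolarKernel

/-! ### Erasure probabilities as sums over erasure patterns -/

/-- The `i`-th bit cannot be recovered from the outputs outside the erased positions `S` and the
bits preceding `i`. -/
def IsErased {l : ℕ} (K : Matrix (Fin l) (Fin l) (ZMod 2)) (i : Fin l) (S : Finset (Fin l)) :
    Prop :=
  ∃ u : Fin l → ZMod 2, u i = 1 ∧ (∀ j < i, u j = 0) ∧ ∀ j ∉ S, (u ᵥ* K) j = 0

/-- The set of erased positions of an output vector. -/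
def erasures {l : ℕ} (y : Fin l → Option (ZMod 2)) : Finset (Fin l) :=
  Finset.univ.filter fun j => y j = none

theorem mem_erasures {l : ℕ} (y : Fin l → Option (ZMod 2)) (j : Fin l) :
    j ∈ erasures y ↔ y j = none := by
  simp [erasures]

theorem eq_some_of_powerChannel_ne_zero {l : ℕ} {z : ℝ} {x : Fin l → ZMod 2}
    {y : Fin l → Option (ZMod 2)} (h : powerChannel (bec z) l x y ≠ 0) {j : Fin l}
    (hj : j ∉ erasures y) : y j = some (x j) := by
  have h1 : bec z (x j) (y j) ≠ 0 := (Finset.prod_ne_zero_iff.1 h) j (Finset.mem_univ j)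
  rw [mem_erasures] at hj
  cases hy : y j with
  | none => exact absurd hy hj
  | some b =>
    rw [hy] at h1
    simp only [bec, ne_eq, ite_eq_right_iff, not_forall] at h1
    rw [h1.1]

theorem powerChannel_congr {l : ℕ} (z : ℝ) {x x' : Fin l → ZMod 2}
    {y : Fin l → Option (ZMod 2)} (h : ∀ j ∉ erasures y, x j = x' j) :
    powerChannel (bec z) l x y = powerChannel (bec z) l x' y := by
  refine Finset.prod_congr rfl fun j _ => ?_
  by_cases hj : j ∈ erasures y
  · rw [mem_erasures] at hj
    rw [hj]
    rfl
  · rw [h j hj]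

/-- Translation by the witness `w` matches the vectors with `u i = 0` to those with `u i = 1`, and
alters the codeword at erased positions only. -/
theorem bitChannel_zero_eq_one_of_isErased {l : ℕ} (z : ℝ) {K : Matrix (Fin l) (Fin l) (ZMod 2)}
    {i : Fin l} {o : (Fin l → Option (ZMod 2)) × ({j : Fin l // j < i} → ZMod 2)}
    (h : IsErased K i (erasures o.1)) :
    bitChannel (bec z) K i 0 o = bitChannel (bec z) K i 1 o := by
  obtain ⟨w, hwi, hw0, hwK⟩ := h
  unfold bitChannel
  congr 1
  refine Finset.sum_bij' (fun u _ => u + w) (fun u _ => u - w) ?_ ?_ ?_ ?_ ?_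
  · intro u hu
    simp only [Finset.mem_filter, Finset.mem_univ, true_and, Pi.add_apply] at hu ⊢
    refine ⟨fun j => ?_, by rw [hu.2, hwi, zero_add]⟩
    rw [hu.1 j, hw0 j j.2, add_zero]
  · intro u hu
    simp only [Finset.mem_filter, Finset.mem_univ, true_and, Pi.sub_apply] at hu ⊢
    refine ⟨fun j => ?_, by rw [hu.2, hwi, sub_self]⟩
    rw [hu.1 j, hw0 j j.2, sub_zero]
  · intro u _
    simp
  · intro u _
    simp
  · intro u _
    refine powerChannel_congr z fun j hj => ?_
    rw [Matrix.add_vecMul, Pi.add_apply, hwK j hj, add_zero]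

/-- Both inputs can produce the output, so each has a compatible vector; their difference is the
witness. -/
theorem isErased_of_bitChannel_eq {l : ℕ} {z : ℝ} {K : Matrix (Fin l) (Fin l) (ZMod 2)}
    {i : Fin l} {o : (Fin l → Option (ZMod 2)) × ({j : Fin l // j < i} → ZMod 2)}
    (h : bitChannel (bec z) K i 0 o = bitChannel (bec z) K i 1 o)
    (h0 : bitChannel (bec z) K i 0 o ≠ 0) : IsErased K i (erasures o.1) := by
  have h1 : bitChannel (bec z) K i 1 o ≠ 0 := h ▸ h0
  obtain ⟨u, hu, hu'⟩ := Finset.exists_ne_zero_of_sum_ne_zero (right_ne_zero_of_mul h0)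
  obtain ⟨v, hv, hv'⟩ := Finset.exists_ne_zero_of_sum_ne_zero (right_ne_zero_of_mul h1)
  simp only [Finset.mem_filter, Finset.mem_univ, true_and] at hu hv
  refine ⟨v - u, by simp [hu.2, hv.2], fun j hj => ?_, fun j hj => ?_⟩
  · have e1 := hu.1 ⟨j, hj⟩
    have e2 := hv.1 ⟨j, hj⟩
    simp only at e1 e2
    rw [Pi.sub_apply, e1, e2, sub_self]
  · have e1 := eq_some_of_powerChannel_ne_zero hu' hj
    have e2 := eq_some_of_powerChannel_ne_zero hv' hj
    rw [e1, Option.some_inj] at e2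
    rw [Matrix.sub_vecMul, Pi.sub_apply, e2, sub_self]

theorem sum_powerChannel_fiber {l : ℕ} (z : ℝ) (x : Fin l → ZMod 2) (S : Finset (Fin l)) :
    ∑ y : Fin l → Option (ZMod 2) with erasures y = S, powerChannel (bec z) l x y =
      z ^ S.card * (1 - z) ^ (l - S.card) := by
  rw [Finset.sum_eq_single (fun j => if j ∈ S then none else some (x j))]
  · unfold powerChannel
    have : ∀ j, bec z (x j) (if j ∈ S then none else some (x j)) =
        if j ∈ S then z else 1 - z := by
      intro j
      split_ifs <;> simp [bec]
    simp only [this]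
    rw [Finset.prod_ite]
    simp [Finset.filter_not, Finset.card_sdiff]
  · intro y hy hne
    by_contra h0
    apply hne
    funext j
    simp only [Finset.mem_filter, Finset.mem_univ, true_and] at hy
    split_ifs with hj
    · rwa [← hy, mem_erasures] at hj
    · rw [← hy] at hj
      exact eq_some_of_powerChannel_ne_zero h0 hj
  · intro h
    exfalso
    apply h
    rw [Finset.mem_filter]
    refine ⟨Finset.mem_univ _, Finset.ext fun j => ?_⟩
    simp [mem_erasures]

/-- The probability that the set of positions erased by `l` uses of `BEC(z)` satisfies `Q`. -/
noncomputable def erasureWeight {l : ℕ} (Q : Finset (Fin l) → Prop) (z : ℝ) : ℝ :=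
  open Classical in
  ∑ S : Finset (Fin l) with Q S, z ^ S.card * (1 - z) ^ (l - S.card)

/-- The value does not depend on the codeword `x`, which makes the average over inputs in
`bitChannel` trivial. -/
theorem sum_powerChannel_erasures {l : ℕ} (z : ℝ) (x : Fin l → ZMod 2)
    (Q : Finset (Fin l) → Prop) [DecidablePred Q] :
    ∑ y : Fin l → Option (ZMod 2) with Q (erasures y), powerChannel (bec z) l x y =
      erasureWeight Q z := by
  classical
  unfold erasureWeight
  rw [← Finset.sum_fiberwise_of_maps_to (s := Finset.univ.filter fun y => Q (erasures y))
    (t := Finset.univ.filter Q) (g := erasures) (by simp)]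
  refine Finset.sum_congr (by ext; simp) fun S hS => ?_
  rw [← sum_powerChannel_fiber z x S]
  refine Finset.sum_congr ?_ fun _ _ => rfl
  ext y
  simp only [Finset.mem_filter, Finset.mem_univ, true_and] at hS ⊢
  exact ⟨fun h => h.2, fun h => ⟨h ▸ hS, h⟩⟩

theorem card_apply_eq_zero {l : ℕ} (i : Fin l) :
    (Finset.univ.filter fun u : Fin l → ZMod 2 => u i = 0).card = 2 ^ (l - 1) := by
  have h2 : (Finset.univ.filter fun u : Fin l → ZMod 2 => u i = 0).card =
      Fintype.card ({j : Fin l // j ≠ i} → ZMod 2) := by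
    rw [← Finset.card_univ]
    refine Finset.card_bij' (fun u _ j => u j) (fun w _ j => if h : j = i then 0 else w ⟨j, h⟩)
      (by simp) (by simp) ?_ ?_
    · intro u hu
      funext j
      simp only [Finset.mem_filter, Finset.mem_univ, true_and] at hu
      by_cases h : j = i
      · subst h; simp [hu]
      · simp [h]
    · intro w _
      funext j
      simp [j.2]
  rw [h2]
  simp [Fintype.card_subtype_compl, ZMod.card]

theorem polarizationBehavior_eq {l : ℕ} (K : Matrix (Fin l) (Fin l) (ZMod 2)) (i : Fin l)
    (z : ℝ) : polarizationBehavior K i z = erasureWeight (IsErased K i) z := by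
  classical
  unfold polarizationBehavior erasureProb
  -- Equal likelihoods without an erasure are both zero, so such outputs add nothing.
  have e1 : ∑ o : (Fin l → Option (ZMod 2)) × ({j : Fin l // j < i} → ZMod 2) with
      bitChannel (bec z) K i 0 o = bitChannel (bec z) K i 1 o, bitChannel (bec z) K i 0 o =
      ∑ o : (Fin l → Option (ZMod 2)) × ({j : Fin l // j < i} → ZMod 2) with
        IsErased K i (erasures o.1), bitChannel (bec z) K i 0 o := by
    symm
    refine Finset.sum_subset_zero_on_sdiff (fun o ho => ?_) (fun o ho => ?_) fun _ _ => rfl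
    · simp only [Finset.mem_filter, Finset.mem_univ, true_and] at ho ⊢
      exact bitChannel_zero_eq_one_of_isErased z ho
    · simp only [Finset.mem_sdiff, Finset.mem_filter, Finset.mem_univ, true_and] at ho
      by_contra h
      exact ho.2 (isErased_of_bitChannel_eq ho.1 h)
  -- Summing over the known prefix frees the bits before `i`; only the constraint `u i = 0`
  -- survives, and the number of such `u` cancels the normalization.
  have e2 : ∑ o : (Fin l → Option (ZMod 2)) × ({j : Fin l // j < i} → ZMod 2) with
        IsErased K i (erasures o.1), bitChannel (bec z) K i 0 o =
      1 / 2 ^ (l - 1) * ∑ u : Fin l → ZMod 2 with u i = 0,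
        ∑ y : Fin l → Option (ZMod 2) with IsErased K i (erasures y),
          powerChannel (bec z) l (u ᵥ* K) y := by
    unfold bitChannel
    rw [← Finset.mul_sum, Finset.sum_filter, Fintype.sum_prod_type]
    congr 1
    rw [Finset.sum_comm (s := Finset.univ.filter fun u : Fin l → ZMod 2 => u i = 0),
      Finset.sum_filter]
    refine Finset.sum_congr rfl fun y _ => ?_
    split_ifs with hy
    · rw [← Finset.sum_fiberwise (s := Finset.univ.filter fun u : Fin l → ZMod 2 => u i = 0)
        (g := fun u (j : {j : Fin l // j < i}) => u j)]
      refine Finset.sum_congr rfl fun v _ => Finset.sum_congr ?_ fun _ _ => rfl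
      ext u
      simp only [Finset.mem_filter, Finset.mem_univ, true_and, funext_iff]
      tauto
    · simp
  rw [e1, e2]
  simp only [sum_powerChannel_erasures z _ (IsErased K i), Finset.sum_const, card_apply_eq_zero, nsmul_eq_mul]
  push_cast
  field_simp

/-! ### Images of a vector under a random nonsingular matrix -/

/-- The isomorphism between the lines spanned by `v` and `w` extends to an automorphism of the whole
space. -/
theorem exists_generalLinearGroup_mulVec_eq {l : ℕ} {F : Type*} [Field F] {v w : Fin l → F}
    (hv : v ≠ 0) (hw : w ≠ 0) :
    ∃ H : Matrix.GeneralLinearGroup (Fin l) F, (H : Matrix (Fin l) (Fin l) F) *ᵥ v = w := by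
  obtain ⟨g, hg⟩ := Submodule.exists_linearEquiv_restrict_eq
    ((LinearEquiv.toSpanNonzeroSingleton F (Fin l → F) v hv).symm ≪≫ₗ
      LinearEquiv.toSpanNonzeroSingleton F (Fin l → F) w hw)
  refine ⟨Matrix.GeneralLinearGroup.toLin.symm (LinearMap.GeneralLinearGroup.ofLinearEquiv g), ?_⟩
  have h1 := Matrix.GeneralLinearGroup.toLin_apply
    (Matrix.GeneralLinearGroup.toLin.symm (LinearMap.GeneralLinearGroup.ofLinearEquiv g)) v
  rw [MulEquiv.apply_symm_apply, Matrix.mulVecLin_apply] at h1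
  rw [← h1]
  have h2 := hg ⟨v, Submodule.mem_span_singleton_self v⟩
  have h3 : (LinearEquiv.toSpanNonzeroSingleton F (Fin l → F) v hv).symm
      ⟨v, Submodule.mem_span_singleton_self v⟩ = 1 := by
    rw [LinearEquiv.symm_apply_eq]
    ext1
    simp
  simp only [LinearEquiv.trans_apply, h3] at h2
  simpa using h2.symm

/-- The number of vectors that agree with `c` outside of `S`. -/
theorem card_eq_off {l : ℕ} (S : Finset (Fin l)) (c : Fin l → ZMod 2) :
    (Finset.univ.filter fun u : Fin l → ZMod 2 => ∀ j ∉ S, u j = c j).card = 2 ^ S.card := by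
  have : (Finset.univ.filter fun u : Fin l → ZMod 2 => ∀ j ∉ S, u j = c j) =
      Fintype.piFinset fun j => if j ∈ S then Finset.univ else {c j} := by
    ext u
    simp only [Finset.mem_filter, Finset.mem_univ, true_and, Fintype.mem_piFinset]
    refine forall_congr' fun j => ?_
    split_ifs with h <;> simp [h]
  rw [this, Fintype.card_piFinset]
  have h2 : ∀ j, (if j ∈ S then (Finset.univ : Finset (ZMod 2)) else {c j}).card =
      if j ∈ S then 2 else 1 := by
    intro j
    split_ifs <;> simp [ZMod.card]
  simp [h2]

theorem card_mulVec_eq {l : ℕ} {y v w : Fin l → ZMod 2} (hv : v ≠ 0) (hw : w ≠ 0) :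
    (Finset.univ.filter fun K : Matrix.GeneralLinearGroup (Fin l) (ZMod 2) =>
      (K : Matrix (Fin l) (Fin l) (ZMod 2)) *ᵥ y = v).card =
    (Finset.univ.filter fun K : Matrix.GeneralLinearGroup (Fin l) (ZMod 2) =>
      (K : Matrix (Fin l) (Fin l) (ZMod 2)) *ᵥ y = w).card := by
  obtain ⟨H, hH⟩ := exists_generalLinearGroup_mulVec_eq hv hw
  refine Finset.card_equiv (Equiv.mulLeft H) fun K => ?_
  simp only [Finset.mem_filter, Finset.mem_univ, true_and, Equiv.coe_mulLeft, Units.val_mul]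
  rw [← Matrix.mulVec_mulVec, ← hH]
  refine ⟨fun h => by rw [h], fun h => ?_⟩
  exact Matrix.mulVec_injective_of_isUnit H.isUnit h

theorem mulVec_ne_zero {l : ℕ} {y : Fin l → ZMod 2} (hy : y ≠ 0)
    (K : Matrix.GeneralLinearGroup (Fin l) (ZMod 2)) :
    (K : Matrix (Fin l) (Fin l) (ZMod 2)) *ᵥ y ≠ 0 := by
  intro h
  exact hy (Matrix.mulVec_injective_of_isUnit K.isUnit (by simpa using h))

/-- The image of a nonzero vector under a random nonsingular matrix is uniform among the nonzero
vectors. -/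
theorem card_mulVec_mem {l : ℕ} {y : Fin l → ZMod 2} (hy : y ≠ 0)
    (A : Finset (Fin l → ZMod 2)) (hA : 0 ∉ A) :
    (Finset.univ.filter fun K : Matrix.GeneralLinearGroup (Fin l) (ZMod 2) =>
      (K : Matrix (Fin l) (Fin l) (ZMod 2)) *ᵥ y ∈ A).card * (2 ^ l - 1) =
    A.card * Fintype.card (Matrix.GeneralLinearGroup (Fin l) (ZMod 2)) := by
  have key : ∀ B : Finset (Fin l → ZMod 2), 0 ∉ B →
      (Finset.univ.filter fun K : Matrix.GeneralLinearGroup (Fin l) (ZMod 2) =>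
        (K : Matrix (Fin l) (Fin l) (ZMod 2)) *ᵥ y ∈ B).card =
      B.card * (Finset.univ.filter fun K : Matrix.GeneralLinearGroup (Fin l) (ZMod 2) =>
        (K : Matrix (Fin l) (Fin l) (ZMod 2)) *ᵥ y = y).card := by
    intro B hB
    rw [Finset.card_eq_sum_card_fiberwise (t := B)
      (f := fun K : Matrix.GeneralLinearGroup (Fin l) (ZMod 2) =>
        (K : Matrix (Fin l) (Fin l) (ZMod 2)) *ᵥ y) (fun K hK => by simpa using hK)]
    rw [← smul_eq_mul, ← Finset.sum_const]
    refine Finset.sum_congr rfl fun w hw => ?_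
    rw [← card_mulVec_eq (y := y) (v := w) (fun h => hB (h ▸ hw)) hy, Finset.filter_filter]
    congr 1
    ext K
    simp only [Finset.mem_filter, Finset.mem_univ, true_and]
    exact ⟨fun h => h.2, fun h => ⟨h ▸ hw, h⟩⟩
  have h1 := key (Finset.univ.erase 0) (by simp)
  have h2 : (Finset.univ.erase (0 : Fin l → ZMod 2)).card = 2 ^ l - 1 := by
    rw [Finset.card_erase_of_mem (Finset.mem_univ _), Finset.card_univ]
    simp [ZMod.card]
  rw [Finset.filter_true_of_mem (fun K _ => by simpa using mulVec_ne_zero hy K), h2,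
    Finset.card_univ] at h1
  rw [key A hA, h1]
  ring

theorem card_mulVec_eq_zero_off {l : ℕ} {y : Fin l → ZMod 2} (hy : y ≠ 0)
    (S : Finset (Fin l)) :
    (Finset.univ.filter fun K : Matrix.GeneralLinearGroup (Fin l) (ZMod 2) =>
      ∀ j ∉ S, ((K : Matrix (Fin l) (Fin l) (ZMod 2)) *ᵥ y) j = 0).card * 2 ^ l ≤
    2 ^ S.card * Fintype.card (Matrix.GeneralLinearGroup (Fin l) (ZMod 2)) := by
  have h1 := card_mulVec_mem hy
    ((Finset.univ.filter fun u : Fin l → ZMod 2 => ∀ j ∉ S, u j = (0 : Fin l → ZMod 2) j).erase 0)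
    (by simp)
  rw [Finset.card_erase_of_mem (by simp), card_eq_off] at h1
  have h2 : (Finset.univ.filter fun K : Matrix.GeneralLinearGroup (Fin l) (ZMod 2) =>
      (K : Matrix (Fin l) (Fin l) (ZMod 2)) *ᵥ y ∈
        (Finset.univ.filter fun u : Fin l → ZMod 2 =>
          ∀ j ∉ S, u j = (0 : Fin l → ZMod 2) j).erase 0) =
      (Finset.univ.filter fun K : Matrix.GeneralLinearGroup (Fin l) (ZMod 2) =>
        ∀ j ∉ S, ((K : Matrix (Fin l) (Fin l) (ZMod 2)) *ᵥ y) j = 0) := by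
    ext K
    simp [mulVec_ne_zero hy K]
  rw [h2] at h1
  -- The exact proportion is (2^|S| - 1)/(2^l - 1). Adding the trivial bound by the group order to
  -- the identity `h1` replaces it by 2^|S|/2^l.
  have h3 := Finset.card_le_univ
    (Finset.univ.filter fun K : Matrix.GeneralLinearGroup (Fin l) (ZMod 2) =>
      ∀ j ∉ S, ((K : Matrix (Fin l) (Fin l) (ZMod 2)) *ᵥ y) j = 0)
  have h4 : 1 ≤ 2 ^ l := Nat.one_le_two_pow
  have h5 : 1 ≤ 2 ^ S.card := Nat.one_le_two_pow
  zify [h4, h5] at h1 h3 ⊢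
  linarith

/-- Transposition is an injection of the group into itself that turns row images into column images.
-/
theorem card_vecMul_eq_zero_off {l : ℕ} {x : Fin l → ZMod 2} (hx : x ≠ 0)
    (S : Finset (Fin l)) :
    (Finset.univ.filter fun K : Matrix.GeneralLinearGroup (Fin l) (ZMod 2) =>
      ∀ j ∉ S, (x ᵥ* (K : Matrix (Fin l) (Fin l) (ZMod 2))) j = 0).card * 2 ^ l ≤
    2 ^ S.card * Fintype.card (Matrix.GeneralLinearGroup (Fin l) (ZMod 2)) := by
  refine le_trans (Nat.mul_le_mul_right _ ?_) (card_mulVec_eq_zero_off hx S)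
  let T : Matrix.GeneralLinearGroup (Fin l) (ZMod 2) → Matrix.GeneralLinearGroup (Fin l) (ZMod 2) :=
    fun K => Matrix.GeneralLinearGroup.mk'' (K : Matrix (Fin l) (Fin l) (ZMod 2))ᵀ
      (by rw [Matrix.det_transpose]; exact (Matrix.isUnit_iff_isUnit_det _).1 K.isUnit)
  have hT : ∀ K, (T K : Matrix (Fin l) (Fin l) (ZMod 2)) =
      (K : Matrix (Fin l) (Fin l) (ZMod 2))ᵀ := fun K => rfl
  refine Finset.card_le_card_of_injOn T ?_ ?_
  · intro K hK
    simpa [hT, Matrix.mulVec_transpose] using hK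
  · intro K _ K' _ h
    have h1 : (K : Matrix (Fin l) (Fin l) (ZMod 2))ᵀ = (K' : Matrix (Fin l) (Fin l) (ZMod 2))ᵀ := by
      rw [← hT, ← hT, h]
    exact Units.ext (Matrix.transpose_injective h1)

/-! ### Probability that a pattern erases, or fails to erase, a bit -/

open Classical in
-- Union bound over the 2^(l - 1 - i) vectors whose first nonzero coordinate is at `i`.
theorem card_isErased_mul_le {l : ℕ} (i : Fin l) (S : Finset (Fin l)) :
    (Finset.univ.filter fun K : Matrix.GeneralLinearGroup (Fin l) (ZMod 2) =>
      IsErased (K : Matrix (Fin l) (Fin l) (ZMod 2)) i S).card * 2 ^ (i : ℕ) ≤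
    2 ^ S.card * Fintype.card (Matrix.GeneralLinearGroup (Fin l) (ZMod 2)) := by
  set V := Finset.univ.filter fun u : Fin l → ZMod 2 =>
    ∀ j ∉ Finset.Ioi i, u j = (Pi.single i 1 : Fin l → ZMod 2) j with hV
  have hVc : V.card = 2 ^ (l - 1 - i) := by
    rw [hV, card_eq_off, Fin.card_Ioi]
  have hsub : (Finset.univ.filter fun K : Matrix.GeneralLinearGroup (Fin l) (ZMod 2) =>
      IsErased (K : Matrix (Fin l) (Fin l) (ZMod 2)) i S) ⊆
      V.biUnion fun u => Finset.univ.filter fun K : Matrix.GeneralLinearGroup (Fin l) (ZMod 2) =>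
        ∀ j ∉ S, (u ᵥ* (K : Matrix (Fin l) (Fin l) (ZMod 2))) j = 0 := by
    intro K hK
    simp only [Finset.mem_filter, Finset.mem_univ, true_and] at hK
    obtain ⟨u, hui, hu0, huK⟩ := hK
    simp only [Finset.mem_biUnion, Finset.mem_filter, Finset.mem_univ, true_and, hV]
    refine ⟨u, fun j hj => ?_, huK⟩
    rw [Finset.mem_Ioi, not_lt] at hj
    rcases hj.lt_or_eq with h | h
    · rw [hu0 j h, Pi.single_eq_of_ne h.ne]
    · rw [h, hui, Pi.single_eq_same]
  have h1 := (Finset.card_le_card hsub).trans Finset.card_biUnion_le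
  have h2 : (∑ u ∈ V, (Finset.univ.filter fun K : Matrix.GeneralLinearGroup (Fin l) (ZMod 2) =>
        ∀ j ∉ S, (u ᵥ* (K : Matrix (Fin l) (Fin l) (ZMod 2))) j = 0).card) * 2 ^ l ≤
      2 ^ (l - 1 - i) * (2 ^ S.card *
        Fintype.card (Matrix.GeneralLinearGroup (Fin l) (ZMod 2))) := by
    rw [Finset.sum_mul, ← hVc, ← smul_eq_mul, ← Finset.sum_const]
    refine Finset.sum_le_sum fun u hu => card_vecMul_eq_zero_off (fun h => ?_) S
    simp only [hV, Finset.mem_filter, Finset.mem_univ, true_and] at hu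
    have := hu i (by simp)
    rw [h, Pi.single_eq_same] at this
    exact zero_ne_one this
  have h3 := (Nat.mul_le_mul_right (2 ^ l) h1).trans h2
  have h4 : 2 ^ l = 2 ^ (l - 1 - i) * (2 * 2 ^ (i : ℕ)) := by
    rw [← pow_succ', ← pow_add]
    congr 1
    have := i.2
    omega
  rw [h4, ← mul_assoc, mul_comm _ (2 ^ (l - 1 - (i : ℕ))), mul_assoc] at h3
  have h5 := Nat.le_of_mul_le_mul_left h3 (by positivity)
  -- The union bound gives 2^(|S| - i - 1); the factor 2 is given up.
  refine le_trans ?_ h5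
  exact Nat.mul_le_mul_left _ (by omega)

/-- Row `i` of `K` lies outside the span of the later rows and the vectors vanishing on `S`, since
otherwise a combination would witness erasure. A functional separating it from that span is the dot
product with some `y`. It kills the vectors vanishing on `S`, so `y` is supported on `S`; it kills
the later rows, so `K *ᵥ y` vanishes beyond `i`. -/
theorem exists_mulVec_eq_zero_of_not_isErased {l : ℕ} {K : Matrix (Fin l) (Fin l) (ZMod 2)}
    {i : Fin l} {S : Finset (Fin l)} (h : ¬ IsErased K i Sᶜ) :
    ∃ y : Fin l → ZMod 2, y ≠ 0 ∧ (∀ j ∉ S, y j = 0) ∧ ∀ j, i < j → (K *ᵥ y) j = 0 := by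
  set V : Submodule (ZMod 2) (Fin l → ZMod 2) := Submodule.pi (Set.Iic i) fun _ => ⊥ with hV
  set P : Submodule (ZMod 2) (Fin l → ZMod 2) := Submodule.pi (S : Set (Fin l)) fun _ => ⊥ with hP
  have hrow : Pi.single i 1 ᵥ* K ∉ V.map K.vecMulLinear ⊔ P := by
    intro hmem
    obtain ⟨a, ha, b, hb, hab⟩ := Submodule.mem_sup.1 hmem
    obtain ⟨v, hv, rfl⟩ := ha
    have hv' : ∀ j ≤ i, v j = 0 := by simpa [hV, Submodule.mem_pi] using hv
    have hb' : ∀ j ∈ S, b j = 0 := by simpa [hP, Submodule.mem_pi] using hb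
    apply h
    refine ⟨Pi.single i 1 - v, by simp [hv' i le_rfl], fun j hj => ?_, fun j hj => ?_⟩
    · simp [hv' j hj.le, hj.ne]
    · rw [Finset.mem_compl, not_not] at hj
      rw [Matrix.sub_vecMul, ← hab]
      simp [hb' j hj]
  obtain ⟨f, hf, hle⟩ := Submodule.exists_le_ker_of_notMem hrow
  have hfd : ∀ x : Fin l → ZMod 2, f x = x ⬝ᵥ fun j => f (Pi.single j 1) := by
    intro x
    conv_lhs => rw [← Finset.univ_sum_single x]
    rw [map_sum, dotProduct]
    refine Finset.sum_congr rfl fun j _ => ?_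
    rw [← smul_eq_mul, ← map_smul]
    congr 1
    ext k
    simp [Pi.single_apply]
  refine ⟨fun j => f (Pi.single j 1), fun h0 => ?_, fun j hj => ?_, fun j hj => ?_⟩
  · rw [hfd, h0] at hf
    simp at hf
  · refine hle (Submodule.mem_sup_right ?_)
    simp only [hP, Submodule.mem_pi]
    intro k hk
    have : k ≠ j := fun e => hj (e ▸ hk)
    simp [this]
  · have h1 : f (Pi.single j 1 ᵥ* K) = 0 := by
      refine hle (Submodule.mem_sup_left ⟨Pi.single j 1, ?_, rfl⟩)
      simp only [hV, SetLike.mem_coe, Submodule.mem_pi]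
      intro k hk
      have : k ≠ j := (lt_of_le_of_lt hk hj).ne
      simp [this]
    rw [hfd, ← Matrix.dotProduct_mulVec] at h1
    simpa using h1

open Classical in
-- Union bound over the nonzero dual vectors `y` supported on `S`; `l - 1 - i` takes the role that
-- `i` has for erasure.
theorem card_not_isErased_mul_le {l : ℕ} (i : Fin l) (S : Finset (Fin l)) :
    (Finset.univ.filter fun K : Matrix.GeneralLinearGroup (Fin l) (ZMod 2) =>
      ¬ IsErased (K : Matrix (Fin l) (Fin l) (ZMod 2)) i Sᶜ).card * 2 ^ (l - 1 - (i : ℕ)) ≤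
    2 ^ S.card * Fintype.card (Matrix.GeneralLinearGroup (Fin l) (ZMod 2)) := by
  set V := Finset.univ.filter fun u : Fin l → ZMod 2 =>
    ∀ j ∉ S, u j = (0 : Fin l → ZMod 2) j with hV
  have hVc : V.card = 2 ^ S.card := card_eq_off S 0
  have hsub : (Finset.univ.filter fun K : Matrix.GeneralLinearGroup (Fin l) (ZMod 2) =>
      ¬ IsErased (K : Matrix (Fin l) (Fin l) (ZMod 2)) i Sᶜ) ⊆
      (V.erase 0).biUnion fun y =>
        Finset.univ.filter fun K : Matrix.GeneralLinearGroup (Fin l) (ZMod 2) =>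
          ∀ j ∉ Finset.Iic i, ((K : Matrix (Fin l) (Fin l) (ZMod 2)) *ᵥ y) j = 0 := by
    intro K hK
    simp only [Finset.mem_filter, Finset.mem_univ, true_and] at hK
    obtain ⟨y, hy, hyS, hyK⟩ := exists_mulVec_eq_zero_of_not_isErased hK
    simp only [Finset.mem_biUnion, Finset.mem_filter, Finset.mem_univ, true_and, hV,
      Finset.mem_erase]
    exact ⟨y, ⟨hy, hyS⟩, fun j hj => hyK j (by simpa using hj)⟩
  have h1 := (Finset.card_le_card hsub).trans Finset.card_biUnion_le
  have h2 : (∑ y ∈ V.erase 0,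
      (Finset.univ.filter fun K : Matrix.GeneralLinearGroup (Fin l) (ZMod 2) =>
        ∀ j ∉ Finset.Iic i, ((K : Matrix (Fin l) (Fin l) (ZMod 2)) *ᵥ y) j = 0).card) * 2 ^ l ≤
      2 ^ S.card * (2 ^ ((i : ℕ) + 1) *
        Fintype.card (Matrix.GeneralLinearGroup (Fin l) (ZMod 2))) := by
    rw [Finset.sum_mul]
    refine le_trans (b := ∑ y ∈ V.erase 0, 2 ^ ((i : ℕ) + 1) *
      Fintype.card (Matrix.GeneralLinearGroup (Fin l) (ZMod 2))) ?_ ?_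
    · refine Finset.sum_le_sum fun y hy => ?_
      have := card_mulVec_eq_zero_off (Finset.ne_of_mem_erase hy) (Finset.Iic i)
      rwa [Fin.card_Iic] at this
    · rw [Finset.sum_const, smul_eq_mul, ← hVc]
      exact Nat.mul_le_mul_right _ (Finset.card_le_card (Finset.erase_subset _ _))
  have h3 := (Nat.mul_le_mul_right (2 ^ l) h1).trans h2
  have h4 : 2 ^ l = 2 ^ ((i : ℕ) + 1) * 2 ^ (l - 1 - i) := by
    rw [← pow_add]
    congr 1
    have := i.2
    omega
  rw [h4, mul_left_comm, mul_left_comm (2 ^ S.card)] at h3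
  exact Nat.le_of_mul_le_mul_left h3 (by positivity)

/-! ### Bounds for weighted binomial sums -/

theorem exp_le_one_add_self_add_sq {h : ℝ} (hh : |h| ≤ 1) : Real.exp h ≤ 1 + h + h ^ 2 := by
  have := Real.abs_exp_sub_one_sub_id_le hh
  have := (abs_le.1 this).2
  linarith

/-- Since h ≤ 1/2 < log 2, min(1, 2^(e - j)) ≤ exp(h(e - j)) on either side of `j`. The free
parameter `h` is what the Chernoff bound optimizes. -/
theorem min_one_le_exp {L h : ℝ} (hL : 1 ≤ L) (h0 : 0 ≤ h) (h1 : h ≤ 1 / 2) {a : ℝ} (e j : ℕ)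
    (ha : a ≤ 1) (ha' : a ≤ L * (2 ^ e / 2 ^ j)) :
    a ≤ L * Real.exp (h * ((e : ℝ) - j)) := by
  rcases le_total j e with hje | hje
  · have h2 : (j : ℝ) ≤ e := by exact_mod_cast hje
    have h3 : 1 ≤ Real.exp (h * ((e : ℝ) - j)) :=
      Real.one_le_exp (mul_nonneg h0 (by linarith))
    nlinarith
  · have h2 : (e : ℝ) ≤ j := by exact_mod_cast hje
    refine ha'.trans (mul_le_mul_of_nonneg_left ?_ (by linarith))
    have h4 : (2 : ℝ) ^ e / 2 ^ j = Real.exp (Real.log 2 * ((e : ℝ) - j)) := by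
      rw [mul_sub, Real.exp_sub, mul_comm, Real.exp_nat_mul, mul_comm, Real.exp_nat_mul,
        Real.exp_log (by norm_num)]
    rw [h4, Real.exp_le_exp]
    have := Real.log_two_gt_d9
    nlinarith

/-- A Chernoff bound. -/
theorem sum_le_exp_of_le_min {l : ℕ} {a : ℕ → ℝ} {L h z : ℝ} {j : ℕ} (hL : 1 ≤ L) (h0 : 0 ≤ h)
    (h1 : h ≤ 1 / 2) (hz0 : 0 ≤ z) (hz1 : z ≤ 1)
    (ha : ∀ e ≤ l, a e ≤ l.choose e)
    (ha' : ∀ e ≤ l, a e ≤ l.choose e * (L * (2 ^ e / 2 ^ j))) :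
    ∑ e ∈ Finset.range (l + 1), a e * (z ^ e * (1 - z) ^ (l - e)) ≤
      L * Real.exp (-(h * (j - l * z)) + l * h ^ 2) := by
  have hb : ∀ e ≤ l, a e ≤ l.choose e * (L * Real.exp (h * ((e : ℝ) - j))) := by
    intro e he
    have hc : (0 : ℝ) < l.choose e := by exact_mod_cast Nat.choose_pos he
    have := min_one_le_exp hL h0 h1 (a := a e / l.choose e) e j
      ((div_le_one hc).2 (ha e he)) ((div_le_iff₀' hc).2 (ha' e he))
    exact (div_le_iff₀' hc).1 this
  have hz1' : 0 ≤ 1 - z := by linarith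
  calc ∑ e ∈ Finset.range (l + 1), a e * (z ^ e * (1 - z) ^ (l - e))
      ≤ ∑ e ∈ Finset.range (l + 1), L * Real.exp (-(h * j)) *
          ((z * Real.exp h) ^ e * (1 - z) ^ (l - e) * l.choose e) := by
        refine Finset.sum_le_sum fun e he => ?_
        have he' : e ≤ l := Nat.lt_succ_iff.1 (Finset.mem_range.1 he)
        refine (mul_le_mul_of_nonneg_right (hb e he') (by positivity)).trans (le_of_eq ?_)
        have : Real.exp (h * ((e : ℝ) - j)) = Real.exp h ^ e * Real.exp (-(h * j)) := by
          rw [← Real.exp_nat_mul, ← Real.exp_add]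
          congr 1
          ring
        rw [this, mul_pow]
        ring
    _ = L * Real.exp (-(h * j)) * (z * Real.exp h + (1 - z)) ^ l := by
        rw [← Finset.mul_sum, add_pow]
    -- The moment generating function of one use: 1 + z(e^h - 1) ≤ 1 + zh + h² ≤ exp(zh + h²).
    _ ≤ L * Real.exp (-(h * j)) * Real.exp (z * h + h ^ 2) ^ l := by
        have hexp : Real.exp h ≤ 1 + h + h ^ 2 :=
          exp_le_one_add_self_add_sq (by rw [abs_of_nonneg h0]; linarith)
        have h2 := Real.add_one_le_exp (z * h + h ^ 2)
        have h3 : z * Real.exp h ≤ z * (1 + h + h ^ 2) := mul_le_mul_of_nonneg_left hexp hz0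
        have h5 : z * h ^ 2 ≤ 1 * h ^ 2 := mul_le_mul_of_nonneg_right hz1 (sq_nonneg h)
        have h4 : z * Real.exp h + (1 - z) ≤ Real.exp (z * h + h ^ 2) := by nlinarith
        gcongr
    _ = _ := by
        rw [mul_assoc, ← Real.exp_nat_mul, ← Real.exp_add]
        congr 2
        ring

theorem one_add_pow_sub_one_le {l : ℕ} {x : ℝ} (hx : 0 ≤ x) (h : l * x ≤ 1) :
    (1 + x) ^ l - 1 ≤ 2 * (l * x) := by
  have h1 : (1 + x) ^ l ≤ Real.exp (l * x) := by
    rw [Real.exp_nat_mul]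
    have := Real.add_one_le_exp x
    gcongr
    linarith
  have h0 : 0 ≤ l * x := by positivity
  have h2 := exp_le_one_add_self_add_sq (h := l * x) (by rw [abs_of_nonneg h0]; exact h)
  nlinarith

/-- Without the term `e = 0`, and with the powers of 1 - z bounded by 1, the binomial theorem leaves
(1 + rz)^l - 1, which is linear in z when lrz ≤ 1. -/
theorem sum_le_of_apply_zero {l : ℕ} {a : ℕ → ℝ} {M r z : ℝ} (hM : 0 ≤ M) (hr : 0 ≤ r)
    (hz0 : 0 ≤ z) (hz1 : z ≤ 1) (hrz : l * (r * z) ≤ 1) (ha0 : a 0 ≤ 0)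
    (ha : ∀ e ≤ l, a e ≤ l.choose e * (M * r ^ e)) :
    ∑ e ∈ Finset.range (l + 1), a e * (z ^ e * (1 - z) ^ (l - e)) ≤ M * (2 * (l * (r * z))) := by
  have hz1' : 0 ≤ 1 - z := by linarith
  refine le_trans ?_ (mul_le_mul_of_nonneg_left
    (one_add_pow_sub_one_le (mul_nonneg hr hz0) hrz) hM)
  have e1 : (1 + r * z) ^ l - 1 =
      ∑ e ∈ Finset.range l, (r * z) ^ (e + 1) * (l.choose (e + 1) : ℝ) := by
    rw [add_comm 1, add_pow, Finset.sum_range_succ']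
    simp
  rw [e1, Finset.sum_range_succ', Finset.mul_sum]
  have h0 : a 0 * (z ^ 0 * (1 - z) ^ (l - 0)) ≤ 0 :=
    mul_nonpos_of_nonpos_of_nonneg ha0 (by positivity)
  refine (add_le_of_nonpos_right h0).trans (Finset.sum_le_sum fun e he => ?_)
  have he' : e + 1 ≤ l := Finset.mem_range.1 he
  calc a (e + 1) * (z ^ (e + 1) * (1 - z) ^ (l - (e + 1)))
      ≤ (l.choose (e + 1) * (M * r ^ (e + 1))) * (z ^ (e + 1) * (1 - z) ^ (l - (e + 1))) :=
        mul_le_mul_of_nonneg_right (ha _ he') (by positivity)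
    _ ≤ (l.choose (e + 1) * (M * r ^ (e + 1))) * (z ^ (e + 1) * 1) := by
        have : (1 - z) ^ (l - (e + 1)) ≤ 1 := pow_le_one₀ hz1' (by linarith)
        gcongr
    _ = _ := by
        rw [mul_pow]
        ring

/-! ### Counting patterns by size -/

/-- The number of sets of size `e` that satisfy `Q`. -/
noncomputable def cardCount {l : ℕ} (Q : Finset (Fin l) → Prop) (e : ℕ) : ℝ :=
  open Classical in
  ((Finset.univ.filter fun S : Finset (Fin l) => S.card = e ∧ Q S).card : ℝ)

theorem cardCount_le_choose {l : ℕ} (Q : Finset (Fin l) → Prop) (e : ℕ) :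
    cardCount Q e ≤ l.choose e := by
  classical
  unfold cardCount
  have h : (Finset.powersetCard e (Finset.univ : Finset (Fin l))).card = l.choose e := by
    rw [Finset.card_powersetCard, Finset.card_univ, Fintype.card_fin]
  rw [← h]
  refine Nat.cast_le.2 (Finset.card_le_card fun S hS => ?_)
  simp only [Finset.mem_filter, Finset.mem_univ, true_and] at hS
  simp [Finset.mem_powersetCard, hS.1]

theorem cardCount_zero {l : ℕ} {Q : Finset (Fin l) → Prop} (hQ : ¬ Q ∅) : cardCount Q 0 ≤ 0 := by
  classical
  unfold cardCount
  rw [Finset.filter_false_of_mem]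
  · simp
  · rintro S - ⟨h1, h2⟩
    rw [Finset.card_eq_zero] at h1
    exact hQ (h1 ▸ h2)

theorem sum_eq_sum_range_card {l : ℕ} (Q : Finset (Fin l) → Prop) [DecidablePred Q] (φ : ℕ → ℝ) :
    ∑ S : Finset (Fin l) with Q S, φ S.card =
      ∑ e ∈ Finset.range (l + 1), cardCount Q e * φ e := by
  classical
  rw [← Finset.sum_fiberwise_of_maps_to (g := Finset.card) (t := Finset.range (l + 1))]
  · refine Finset.sum_congr rfl fun e _ => ?_
    rw [Finset.sum_congr rfl (g := fun _ => φ e)]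
    · rw [Finset.sum_const, nsmul_eq_mul, cardCount, Finset.filter_filter]
      congr 3
      ext S
      simp [and_comm]
    · intro S hS
      rw [(Finset.mem_filter.1 hS).2]
  · intro S _
    have := Finset.card_le_univ S
    rw [Fintype.card_fin] at this
    exact Finset.mem_range.2 (Nat.lt_succ_iff.2 this)

theorem erasureWeight_eq_sum {l : ℕ} (Q : Finset (Fin l) → Prop) (z : ℝ) :
    erasureWeight Q z =
      ∑ e ∈ Finset.range (l + 1), cardCount Q e * (z ^ e * (1 - z) ^ (l - e)) := by
  classical
  unfold erasureWeight
  exact sum_eq_sum_range_card Q fun e => z ^ e * (1 - z) ^ (l - e)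

theorem erasureWeight_nonneg {l : ℕ} (Q : Finset (Fin l) → Prop) {z : ℝ} (h0 : 0 ≤ z)
    (h1 : z ≤ 1) : 0 ≤ erasureWeight Q z := by
  have : 0 ≤ 1 - z := by linarith
  unfold erasureWeight
  positivity

/-- Complementing patterns exchanges z and 1 - z, so 1 - f obeys the same estimates as f, with the
dual counts. -/
theorem one_sub_erasureWeight {l : ℕ} (Q : Finset (Fin l) → Prop) (z : ℝ) :
    1 - erasureWeight Q z = erasureWeight (fun S => ¬ Q Sᶜ) (1 - z) := by
  classical
  have h1 : ∑ S : Finset (Fin l), z ^ S.card * (1 - z) ^ (l - S.card) = 1 := by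
    have := Fin.sum_pow_mul_eq_add_pow (n := l) z (1 - z)
    rw [this]
    simp
  have h2 : erasureWeight (fun S => ¬ Q Sᶜ) (1 - z) =
      ∑ S : Finset (Fin l) with ¬ Q S, z ^ S.card * (1 - z) ^ (l - S.card) := by
    unfold erasureWeight
    refine Finset.sum_bij' (fun S _ => Sᶜ) (fun S _ => Sᶜ) ?_ ?_ ?_ ?_ ?_
    · intro S hS
      simpa using hS
    · intro S hS
      simpa using hS
    · intro S _
      simp
    · intro S _
      simp
    · intro S _
      have h := Finset.card_le_univ S
      rw [Fintype.card_fin] at h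
      rw [Finset.card_compl, Fintype.card_fin, sub_sub_cancel, Nat.sub_sub_self h, mul_comm]
  have h3 := Finset.sum_filter_add_sum_filter_not Finset.univ Q
    fun S : Finset (Fin l) => z ^ S.card * (1 - z) ^ (l - S.card)
  rw [h1] at h3
  rw [h2, erasureWeight]
  linarith

/-! ### Typical kernels -/

theorem kernelProb_mono {l : ℕ} {A B : Set (Matrix.GeneralLinearGroup (Fin l) (ZMod 2))}
    (h : A ⊆ B) : kernelProb l A ≤ kernelProb l B := by
  unfold kernelProb
  refine ENNReal.toReal_mono ?_ (MeasureTheory.OuterMeasure.mono _ h)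
  classical
  rw [PMF.toOuterMeasure_uniformOfFintype_apply]
  exact ENNReal.div_ne_top (by simp) (by simp)

theorem kernelProb_eq {l : ℕ} (A : Set (Matrix.GeneralLinearGroup (Fin l) (ZMod 2)))
    [DecidablePred (· ∈ A)] :
    kernelProb l A = ((Finset.univ.filter (· ∈ A)).card : ℝ) /
      Fintype.card (Matrix.GeneralLinearGroup (Fin l) (ZMod 2)) := by
  unfold kernelProb
  rw [PMF.toOuterMeasure_uniformOfFintype_apply, ENNReal.toReal_div]
  congr 1
  rw [ENNReal.toReal_natCast]
  congr 1
  exact Fintype.card_subtype _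

open Classical in
/-- Markov's inequality for the number of sets of a given size that satisfy a random property. -/
theorem card_lt_cardCount_mul_le {G : Type*} [Fintype G] {l e j : ℕ}
    (Q : G → Finset (Fin l) → Prop)
    (hQ : ∀ S, (Finset.univ.filter fun K => Q K S).card * 2 ^ j ≤ 2 ^ S.card * Fintype.card G)
    {L : ℝ} (he : e ≤ l) :
    ((Finset.univ.filter fun K =>
      l.choose e * (L * (2 ^ e / 2 ^ j)) < cardCount (Q K) e).card : ℝ) * L ≤
        Fintype.card G := by
  set B := Finset.univ.filter fun K =>
    l.choose e * (L * (2 ^ e / 2 ^ j)) < cardCount (Q K) e with hB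
  -- Double counting of the pairs of a kernel and a pattern.
  have h1 : ∑ K, cardCount (Q K) e =
      ∑ S ∈ Finset.powersetCard e (Finset.univ : Finset (Fin l)),
        ((Finset.univ.filter fun K => Q K S).card : ℝ) := by
    have e1 : ∀ K, cardCount (Q K) e =
        ∑ S ∈ Finset.powersetCard e (Finset.univ : Finset (Fin l)),
          if Q K S then (1 : ℝ) else 0 := by
      intro K
      rw [Finset.sum_boole, cardCount]
      congr 2
      ext S
      simp [Finset.mem_powersetCard]
    simp only [e1]
    rw [Finset.sum_comm]
    refine Finset.sum_congr rfl fun S _ => ?_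
    rw [Finset.sum_boole]
  have h2 : ∑ K, cardCount (Q K) e ≤ l.choose e * (2 ^ e / 2 ^ j * Fintype.card G) := by
    have hc : (Finset.powersetCard e (Finset.univ : Finset (Fin l))).card = l.choose e := by
      rw [Finset.card_powersetCard, Finset.card_univ, Fintype.card_fin]
    rw [h1, ← hc, ← nsmul_eq_mul, ← Finset.sum_const]
    refine Finset.sum_le_sum fun S hS => ?_
    rw [Finset.mem_powersetCard] at hS
    have h3 := hQ S
    rw [hS.2] at h3
    have h4 : ((Finset.univ.filter fun K => Q K S).card : ℝ) * 2 ^ j ≤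
        2 ^ e * Fintype.card G := by exact_mod_cast h3
    rw [div_mul_eq_mul_div, le_div_iff₀ (by positivity)]
    exact h4
  have h3 : (B.card : ℝ) * (l.choose e * (L * (2 ^ e / 2 ^ j))) ≤ ∑ K, cardCount (Q K) e := by
    rw [← nsmul_eq_mul, ← Finset.sum_const]
    refine (Finset.sum_le_sum fun K hK => (Finset.mem_filter.1 hK).2.le).trans ?_
    refine Finset.sum_le_sum_of_subset_of_nonneg (Finset.subset_univ _) fun K _ _ => ?_
    unfold cardCount
    positivity
  have h4 : (0 : ℝ) < l.choose e * (2 ^ e / 2 ^ j) := by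
    have : (0 : ℝ) < l.choose e := by exact_mod_cast Nat.choose_pos he
    positivity
  have h5 := h3.trans h2
  refine le_of_mul_le_mul_left (a := (l.choose e : ℝ) * (2 ^ e / 2 ^ j)) ?_ h4
  linarith

/-- For every bit `i` and every number `e` of erasures, the fraction of erasure patterns of size `e`
that erase bit `i` exceeds the bound on its mean by a factor of at most `l ^ 4`, and the same holds
for the patterns with `e` unerased positions that do not erase bit `i`. -/
def IsTypical {l : ℕ} (K : Matrix (Fin l) (Fin l) (ZMod 2)) : Prop :=
  ∀ i : Fin l, ∀ e ≤ l,
    cardCount (IsErased K i) e ≤ l.choose e * ((l : ℝ) ^ 4 * (2 ^ e / 2 ^ (i : ℕ))) ∧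
    cardCount (fun S => ¬ IsErased K i Sᶜ) e ≤
      l.choose e * ((l : ℝ) ^ 4 * (2 ^ e / 2 ^ (l - 1 - (i : ℕ))))

/-- A union bound. -/
theorem card_not_forall_le {G ι : Type*} [Fintype G] [Fintype ι] (P : ι → G → Prop)
    [∀ p, DecidablePred (P p)] [DecidablePred fun K => ∀ p, P p K] {b : ℝ}
    (hb : ∀ p, ((Finset.univ.filter fun K => ¬ P p K).card : ℝ) ≤ b) :
    ((Finset.univ.filter fun K => ¬ ∀ p, P p K).card : ℝ) ≤ Fintype.card ι * b := by
  classical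
  have hsub : (Finset.univ.filter fun K => ¬ ∀ p, P p K) ⊆
      Finset.univ.biUnion fun p => Finset.univ.filter fun K => ¬ P p K := by
    intro K hK
    simpa using hK
  have h1 := (Finset.card_le_card hsub).trans Finset.card_biUnion_le
  refine (Nat.cast_le (α := ℝ).2 h1).trans ?_
  push_cast
  refine (Finset.sum_le_card_nsmul _ _ _ fun p _ => hb p).trans (le_of_eq ?_)
  rw [nsmul_eq_mul, Finset.card_univ]

open Classical in
theorem card_not_isTypical_le {l : ℕ} (hl : 0 < l) :
    ((Finset.univ.filter fun K : Matrix.GeneralLinearGroup (Fin l) (ZMod 2) =>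
      ¬ IsTypical (K : Matrix (Fin l) (Fin l) (ZMod 2))).card : ℝ) ≤
      (l * (l + 1) * 2) *
        (Fintype.card (Matrix.GeneralLinearGroup (Fin l) (ZMod 2)) / (l : ℝ) ^ 4) := by
  have hl' : (0 : ℝ) < (l : ℝ) ^ 4 := by positivity
  have key := card_not_forall_le (G := Matrix.GeneralLinearGroup (Fin l) (ZMod 2))
    -- The Boolean selects between the erasure count and its dual.
    (ι := (Fin l × Fin (l + 1)) × Bool)
    (fun p K => if p.2 then cardCount (IsErased (K : Matrix (Fin l) (Fin l) (ZMod 2)) p.1.1) p.1.2 ≤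
        l.choose p.1.2 * ((l : ℝ) ^ 4 * (2 ^ (p.1.2 : ℕ) / 2 ^ (p.1.1 : ℕ)))
      else cardCount (fun S => ¬ IsErased (K : Matrix (Fin l) (Fin l) (ZMod 2)) p.1.1 Sᶜ) p.1.2 ≤
        l.choose p.1.2 * ((l : ℝ) ^ 4 * (2 ^ (p.1.2 : ℕ) / 2 ^ (l - 1 - (p.1.1 : ℕ)))))
    (b := Fintype.card (Matrix.GeneralLinearGroup (Fin l) (ZMod 2)) / (l : ℝ) ^ 4) ?_
  · refine le_trans (le_of_eq ?_) (key.trans (le_of_eq ?_))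
    · congr 2
      ext K
      simp only [Finset.mem_filter, Finset.mem_univ, true_and]
      refine not_congr ⟨fun h p => ?_, fun h i e he => ?_⟩
      · split_ifs
        · exact (h p.1.1 p.1.2 (Nat.lt_succ_iff.1 p.1.2.2)).1
        · exact (h p.1.1 p.1.2 (Nat.lt_succ_iff.1 p.1.2.2)).2
      · exact ⟨by simpa using h ((i, ⟨e, Nat.lt_succ_iff.2 he⟩), true),
          by simpa using h ((i, ⟨e, Nat.lt_succ_iff.2 he⟩), false)⟩
    · simp
  · rintro ⟨⟨i, e⟩, _ | _⟩
    · rw [le_div_iff₀ hl']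
      refine le_trans (le_of_eq ?_) (card_lt_cardCount_mul_le
        (fun (K : Matrix.GeneralLinearGroup (Fin l) (ZMod 2)) S =>
          ¬ IsErased (K : Matrix (Fin l) (Fin l) (ZMod 2)) i Sᶜ)
        (fun S => by convert card_not_isErased_mul_le i S) (L := (l : ℝ) ^ 4) (Nat.lt_succ_iff.1 e.2))
      congr 3
      ext K
      simp
    · rw [le_div_iff₀ hl']
      refine le_trans (le_of_eq ?_) (card_lt_cardCount_mul_le
        (fun (K : Matrix.GeneralLinearGroup (Fin l) (ZMod 2)) =>
          IsErased (K : Matrix (Fin l) (Fin l) (ZMod 2)) i)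
        (fun S => card_isErased_mul_le i S) (L := (l : ℝ) ^ 4) (Nat.lt_succ_iff.1 e.2))
      congr 3
      ext K
      simp

theorem kernelProb_isTypical {l : ℕ} (hl : 3 ≤ l) :
    1 - 1 / (l : ℝ) <
      kernelProb l {K | IsTypical (K : Matrix (Fin l) (Fin l) (ZMod 2))} := by
  classical
  have hGpos : (0 : ℝ) < Fintype.card (Matrix.GeneralLinearGroup (Fin l) (ZMod 2)) := by
    exact_mod_cast Fintype.card_pos
  have hl' : (3 : ℝ) ≤ l := by exact_mod_cast hl
  have hcard := card_not_isTypical_le (l := l) (by omega)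
  have hsum : ((Finset.univ.filter fun K : Matrix.GeneralLinearGroup (Fin l) (ZMod 2) =>
      IsTypical (K : Matrix (Fin l) (Fin l) (ZMod 2))).card : ℝ) +
      ((Finset.univ.filter fun K : Matrix.GeneralLinearGroup (Fin l) (ZMod 2) =>
      ¬ IsTypical (K : Matrix (Fin l) (Fin l) (ZMod 2))).card : ℝ) =
      Fintype.card (Matrix.GeneralLinearGroup (Fin l) (ZMod 2)) := by
    exact_mod_cast Finset.card_filter_add_card_filter_not _
  rw [kernelProb_eq, lt_div_iff₀ hGpos]
  simp only [Set.mem_ofPred_eq]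
  generalize (Fintype.card (Matrix.GeneralLinearGroup (Fin l) (ZMod 2)) : ℝ) = g at *
  have h6 : (l * (l + 1) * 2) * (g / (l : ℝ) ^ 4) < 1 / (l : ℝ) * g := by
    have h7 : (l * (l + 1) * 2) * (g / (l : ℝ) ^ 4) =
        (2 * (l + 1) / (l : ℝ) ^ 2) * (1 / (l : ℝ) * g) := by
      field_simp
    rw [h7]
    refine mul_lt_of_lt_one_left (by positivity) ?_
    rw [div_lt_one (by positivity)]
    -- This is 2(l + 1) < l², which holds from l = 3 on.
    nlinarith
  linarith

/-! ### Consequences of the lower bound on `l` -/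

/-- The size of `l` in terms of `α` on which the estimates rely. -/
structure IsLarge (α : ℝ) (l : ℕ) : Prop where
  pos : 0 < α
  lt : α < 1 / 16
  le_logb : 64 ≤ Real.logb 2 l
  logb_logb_le : Real.logb 2 (Real.logb 2 l) ≤ α * Real.logb 2 l

theorem logb_two_two_pow (n : ℕ) : Real.logb 2 ((2 : ℝ) ^ n) = n := by
  rw [Real.logb_pow, Real.logb_self_eq_one (by norm_num), mul_one]

/-- On [3/2, 2), [2, 16) and [16, 64) the logarithm is at least 1/2, 1 and 4, so 16 log₂ x is at
least 8, 16 and 64, against the hypothesis. -/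
theorem le_of_mul_logb_lt {x : ℝ} (hx : 3 / 2 ≤ x) (h : 16 * Real.logb 2 x < x) : 64 ≤ x := by
  by_contra hlt
  push Not at hlt
  rcases lt_or_ge x 2 with h2 | h2
  · have h3 : (1 : ℝ) / 2 ≤ Real.logb 2 x := by
      rw [Real.le_logb_iff_rpow_le (by norm_num) (by linarith), ← Real.sqrt_eq_rpow]
      refine le_trans ?_ hx
      rw [Real.sqrt_le_left (by norm_num)]
      norm_num
    linarith
  · rcases lt_or_ge x 16 with h3 | h3
    · have h4 : (1 : ℝ) ≤ Real.logb 2 x := by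
        rw [Real.le_logb_iff_rpow_le (by norm_num) (by linarith), Real.rpow_one]
        exact h2
      linarith
    · have h4 : (4 : ℝ) ≤ Real.logb 2 x := by
        have := Real.logb_le_logb_of_le (b := 2) (by norm_num) (by norm_num) h3
        have h5 := logb_two_two_pow 4
        norm_num at h5
        linarith
      linarith

theorem isLarge_of_ellOne_le {α : ℝ} (hα₀ : 0 < α) (hα₁ : α < 1 / 16) {l : ℕ}
    (hl : ellOne α ≤ l) : IsLarge α l := by
  obtain ⟨⟨h2, hr⟩, -⟩ := ellOne_isLeast α
  set n := ellOne α
  set x := Real.logb 2 n with hx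
  have hn : (3 : ℝ) ≤ n := by exact_mod_cast h2
  have hx1 : 3 / 2 ≤ x := by
    rw [hx, Real.le_logb_iff_rpow_le (by norm_num) (by linarith)]
    have : (2 : ℝ) ^ (3 / 2 : ℝ) ≤ 3 := by
      rw [← Real.sqrt_sq (x := (2 : ℝ) ^ (3 / 2 : ℝ)) (by positivity), ← Real.rpow_natCast,
        ← Real.rpow_mul (by norm_num)]
      rw [Real.sqrt_le_left (by norm_num)]
      norm_num
    linarith
  have hlx : 0 < Real.logb 2 x := Real.logb_pos (by norm_num) (by linarith)
  have hax : Real.logb 2 x ≤ α * x := by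
    rw [div_le_div_iff₀ hα₀ hlx] at hr
    linarith
  have hx64 : 64 ≤ x := le_of_mul_logb_lt hx1 (by nlinarith)
  have hxy : x ≤ Real.logb 2 l :=
    Real.logb_le_logb_of_le (by norm_num) (by linarith) (by exact_mod_cast hl)
  set y := Real.logb 2 l with hy
  refine ⟨hα₀, hα₁, hx64.trans hxy, ?_⟩
  have hexp : Real.exp 1 ≤ x := by
    have := Real.exp_one_lt_d9
    linarith
  -- log x / x decreases beyond e, so the inequality known at `ellOne α` passes to every larger `l`.
  have hanti := Real.log_div_self_antitoneOn (a := x) hexp (b := y) (hexp.trans hxy) hxy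
  simp only at hanti
  have hx0 : 0 < x := by linarith
  have hy0 : 0 < y := by linarith
  have hl2 : 0 < Real.log 2 := Real.log_pos (by norm_num)
  have e1 : Real.logb 2 y / y ≤ Real.logb 2 x / x := by
    unfold Real.logb
    rw [div_right_comm, div_right_comm (Real.log x)]
    exact div_le_div_of_nonneg_right hanti hl2.le
  have e2 : Real.logb 2 x / x ≤ α := (div_le_iff₀ hx0).2 hax
  exact (div_le_iff₀ hy0).1 (e1.trans e2)

namespace IsLarge

variable {α : ℝ} {l : ℕ}

theorem natCast_pos (h : IsLarge α l) : (0 : ℝ) < l := by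
  have h1 := h.le_logb
  rcases Nat.eq_zero_or_pos l with h0 | h0
  · rw [h0] at h1
    norm_num at h1
  · exact_mod_cast h0

theorem rpow_logb (h : IsLarge α l) : (2 : ℝ) ^ Real.logb 2 (l : ℝ) = l :=
  Real.rpow_logb (by norm_num) (by norm_num) h.natCast_pos

/-- The exponentiated form of `logb_logb_le`; it absorbs logarithmic factors into powers of l^α. -/
theorem logb_le_rpow (h : IsLarge α l) : Real.logb 2 (l : ℝ) ≤ (l : ℝ) ^ α := by
  have h0 : 0 < Real.logb 2 (l : ℝ) := by linarith [h.le_logb]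
  have h1 : (l : ℝ) ^ α = 2 ^ (α * Real.logb 2 (l : ℝ)) := by
    rw [mul_comm, Real.rpow_mul (by norm_num), h.rpow_logb]
  rw [h1]
  conv_lhs => rw [← Real.rpow_logb (b := 2) (by norm_num) (by norm_num) h0]
  exact Real.rpow_le_rpow_of_exponent_le (by norm_num) h.logb_logb_le

theorem le_rpow (h : IsLarge α l) : 64 ≤ (l : ℝ) ^ α := h.le_logb.trans h.logb_le_rpow

theorem one_le_natCast (h : IsLarge α l) : (1 : ℝ) ≤ l := by
  rw [← h.rpow_logb]
  exact Real.one_le_rpow (by norm_num) (by linarith [h.le_logb])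

theorem rpow_pow_le_sqrt (h : IsLarge α l) : ((l : ℝ) ^ α) ^ 8 ≤ √(l : ℝ) := by
  rw [← Real.rpow_natCast, ← Real.rpow_mul h.natCast_pos.le, Real.sqrt_eq_rpow]
  refine Real.rpow_le_rpow_of_exponent_le h.one_le_natCast ?_
  have := h.lt
  push_cast
  linarith

/-- With m = log₂ l ≥ 64, 6 ≤ log₂ m ≤ αm. It makes exp(-m²) smaller than 1/l even after raising to
the power α. -/
theorem mul_logb_le (h : IsLarge α l) :
    6 * Real.logb 2 (l : ℝ) ≤ α * Real.logb 2 (l : ℝ) ^ 2 := by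
  have h1 : 6 ≤ Real.logb 2 (Real.logb 2 (l : ℝ)) := by
    have := Real.logb_le_logb_of_le (b := 2) (by norm_num) (by norm_num) h.le_logb
    have h5 := logb_two_two_pow 6
    norm_num at h5
    linarith
  have := h.logb_logb_le
  have := h.le_logb
  nlinarith

theorem two_mul_logb_le_sqrt (h : IsLarge α l) : 2 * Real.logb 2 (l : ℝ) ≤ √(l : ℝ) := by
  refine le_trans ?_ h.rpow_pow_le_sqrt
  have h1 := h.le_rpow
  have h2 := h.logb_le_rpow
  have h3 : ((l : ℝ) ^ α) ^ 2 ≤ ((l : ℝ) ^ α) ^ 8 :=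
    pow_le_pow_right₀ (by linarith) (by norm_num)
  nlinarith

end IsLarge

/-! ### Erasure probabilities under count bounds -/

/-- For every `e`, the fraction of the sets of size `e` that satisfy `Q` is at most
`l ^ 4 * 2 ^ (e - j)`. -/
def IsCountBounded {l : ℕ} (Q : Finset (Fin l) → Prop) (j : ℕ) : Prop :=
  ∀ e ≤ l, cardCount Q e ≤ l.choose e * ((l : ℝ) ^ 4 * (2 ^ e / 2 ^ j))

theorem IsCountBounded.erasureWeight_le_exp {α : ℝ} {l : ℕ} (h : IsLarge α l)
    {Q : Finset (Fin l) → Prop} {j : ℕ} (hQ : IsCountBounded Q j) {z : ℝ} (hz0 : 0 ≤ z)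
    (hz1 : z ≤ 1) (hj : l * z + 3 * Real.logb 2 l * √(l : ℝ) ≤ j) :
    erasureWeight Q z ≤ Real.exp (-Real.logb 2 (l : ℝ) ^ 2) := by
  have hm := h.le_logb
  have hm2 := h.two_mul_logb_le_sqrt
  have hlm := h.rpow_logb
  have hl0 := h.natCast_pos
  set m := Real.logb 2 (l : ℝ) with hmdef
  have hs : 0 < √(l : ℝ) := Real.sqrt_pos.2 hl0
  have hss : √(l : ℝ) * √(l : ℝ) = l := Real.mul_self_sqrt hl0.le
  have hL : (1 : ℝ) ≤ (l : ℝ) ^ 4 := one_le_pow₀ h.one_le_natCast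
  -- With h = m/√l the gap 3m√l contributes -3m² to the exponent, the quadratic term +m² and the
  -- factor l^4 only 4m log 2; the total is below -m².
  have key := sum_le_exp_of_le_min (l := l) (h := m / √(l : ℝ)) hL (by positivity)
    (by rw [div_le_iff₀ hs]; linarith) hz0 hz1 (fun e _ => cardCount_le_choose Q e) hQ
  rw [erasureWeight_eq_sum]
  refine key.trans ?_
  have h1 : (l : ℝ) ^ 4 = Real.exp (4 * (Real.log 2 * m)) := by
    have : (4 : ℝ) * (Real.log 2 * m) = (4 : ℕ) * (Real.log 2 * m) := by norm_num
    rw [this, Real.exp_nat_mul, ← Real.rpow_def_of_pos (by norm_num : (0 : ℝ) < 2), hlm]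
  rw [h1, ← Real.exp_add, Real.exp_le_exp]
  have h2 : (l : ℝ) * (m / √(l : ℝ)) ^ 2 = m ^ 2 := by
    rw [div_pow, Real.sq_sqrt hl0.le]
    field_simp
  have h3 : 3 * m ^ 2 ≤ m / √(l : ℝ) * (j - l * z) := by
    rw [div_mul_eq_mul_div, le_div_iff₀ hs]
    nlinarith
  rw [h2]
  have h4 := Real.log_two_lt_d9
  nlinarith

/-- The weight is at most l^4 2^(-j) · 4lz ≤ 2^(2 + 5m - m²) z ≤ 2^(-m²/2) z, and αm²/2 ≥ 3m turns
the power α of the first factor into less than 1/l. -/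
theorem IsCountBounded.erasureWeight_rpow_le_of_le {α : ℝ} {l : ℕ} (h : IsLarge α l)
    {Q : Finset (Fin l) → Prop} {j : ℕ} (hQ : IsCountBounded Q j) (hQ0 : ¬ Q ∅) {z : ℝ}
    (hz0 : 0 ≤ z) (hz1 : z ≤ 1 / (l : ℝ) ^ 2) (hj : Real.logb 2 (l : ℝ) ^ 2 ≤ j) :
    erasureWeight Q z ^ α ≤ 1 / l * z ^ α := by
  have hm := h.le_logb
  have hα := h.pos
  have hmα := h.mul_logb_le
  have hlm := h.rpow_logb
  have hl0 := h.natCast_pos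
  have hl1 := h.one_le_natCast
  have hl2 : (2 : ℝ) ≤ l := by
    rw [← hlm]
    exact Real.self_le_rpow_of_one_le (by norm_num) (by linarith)
  set m := Real.logb 2 (l : ℝ) with hmdef
  have hlz : l * (2 * z) ≤ 1 := by
    rw [le_div_iff₀ (by positivity)] at hz1
    nlinarith [mul_nonneg hz0 hl0.le]
  have hz1' : z ≤ 1 := by nlinarith
  have key := sum_le_of_apply_zero (l := l) (M := (l : ℝ) ^ 4 / 2 ^ j) (r := 2) (by positivity)
    (by norm_num) hz0 hz1' hlz (cardCount_zero hQ0)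
    (fun e he => (hQ e he).trans (le_of_eq (by ring)))
  rw [← erasureWeight_eq_sum] at key
  have h1 : (l : ℝ) ^ 4 / 2 ^ j * (2 * (l * (2 * z))) ≤ 2 ^ (2 + 5 * m - m ^ 2) * z := by
    rw [Real.rpow_sub (by norm_num), Real.rpow_add (by norm_num)]
    have e1 : (2 : ℝ) ^ (5 * m) = (l : ℝ) ^ 5 := by
      rw [mul_comm, Real.rpow_mul (by norm_num), hlm]
      norm_cast
    have e2 : (2 : ℝ) ^ (m ^ 2) ≤ 2 ^ j := by
      rw [← Real.rpow_natCast 2 j]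
      exact Real.rpow_le_rpow_of_exponent_le (by norm_num) hj
    rw [e1]
    have e3 : (l : ℝ) ^ 4 / 2 ^ j * (2 * (l * (2 * z))) = 4 * (l : ℝ) ^ 5 * z / 2 ^ j := by ring
    have e4 : (2 : ℝ) ^ (2 : ℝ) * (l : ℝ) ^ 5 / 2 ^ m ^ 2 * z =
        4 * (l : ℝ) ^ 5 * z / 2 ^ m ^ 2 := by
      norm_num
      ring
    rw [e3, e4]
    gcongr
  refine (Real.rpow_le_rpow (erasureWeight_nonneg Q hz0 hz1') (key.trans h1) hα.le).trans ?_
  rw [Real.mul_rpow (by positivity) hz0]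
  refine mul_le_mul_of_nonneg_right ?_ (by positivity)
  rw [← Real.rpow_mul (by norm_num)]
  have e5 : 1 / (l : ℝ) = 2 ^ (-m) := by
    rw [Real.rpow_neg (by norm_num), hlm, one_div]
  rw [e5]
  refine Real.rpow_le_rpow_of_exponent_le (by norm_num) ?_
  have h6 : 2 + 5 * m - m ^ 2 ≤ -(m ^ 2 / 2) := by nlinarith
  nlinarith [mul_le_mul_of_nonneg_right h6 hα.le]

/-- Some position must be erased, whence the weight is at most 2lz. This crude bound serves the few
bits with a small index `j`. -/
theorem erasureWeight_rpow_le {α : ℝ} {l : ℕ} (h : IsLarge α l)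
    {Q : Finset (Fin l) → Prop} (hQ0 : ¬ Q ∅) {z : ℝ}
    (hz0 : 0 ≤ z) (hz1 : z ≤ 1 / (l : ℝ) ^ 2) :
    erasureWeight Q z ^ α ≤ 2 * (l : ℝ) ^ α * z ^ α := by
  have hα := h.pos
  have hl0 := h.natCast_pos
  have hl1 := h.one_le_natCast
  have hlz : l * (1 * z) ≤ 1 := by
    rw [le_div_iff₀ (by positivity)] at hz1
    nlinarith [mul_nonneg hz0 hl0.le]
  have hz1' : z ≤ 1 := by nlinarith
  have key := sum_le_of_apply_zero (l := l) (M := 1) (r := 1) (by positivity)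
    (by norm_num) hz0 hz1' hlz (cardCount_zero hQ0)
    (fun e he => (cardCount_le_choose Q e).trans (le_of_eq (by simp)))
  rw [← erasureWeight_eq_sum] at key
  have e : (1 : ℝ) * (2 * (l * (1 * z))) = 2 * l * z := by ring
  rw [e] at key
  refine (Real.rpow_le_rpow (erasureWeight_nonneg Q hz0 hz1') key hα.le).trans ?_
  rw [Real.mul_rpow (by positivity) hz0, Real.mul_rpow (by norm_num) hl0.le]
  have h2 : (2 : ℝ) ^ α ≤ 2 := by
    refine (Real.rpow_le_rpow_of_exponent_le (by norm_num) (z := 1) ?_).trans (by simp)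
    linarith [h.lt]
  gcongr

/-! ### Summation over the bits -/

theorem card_mem_Ioo_le {l : ℕ} {a b : ℝ} (hab : a ≤ b) :
    ((Finset.univ.filter fun i : Fin l => a < (i : ℕ) ∧ ((i : ℕ) : ℝ) < b).card : ℝ) ≤
      b - a + 1 := by
  have h1 : (Finset.univ.filter fun i : Fin l => a < (i : ℕ) ∧ ((i : ℕ) : ℝ) < b).card ≤
      (Finset.Icc ⌈a⌉ ⌊b⌋).card := by
    refine Finset.card_le_card_of_injOn (fun i : Fin l => ((i : ℕ) : ℤ)) ?_ ?_
    · intro i hi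
      simp only [Finset.coe_filter, Finset.mem_univ, true_and, Set.mem_ofPred_eq] at hi
      simp only [Finset.coe_Icc, Set.mem_Icc, Int.ceil_le, Int.le_floor]
      push_cast
      exact ⟨hi.1.le, hi.2.le⟩
    · intro i _ j _ hij
      simpa [Fin.ext_iff] using hij
  refine (Nat.cast_le (α := ℝ).2 h1).trans ?_
  rw [Int.card_Icc]
  have h2 : (((⌊b⌋ + 1 - ⌈a⌉).toNat : ℕ) : ℝ) = ((max (⌊b⌋ + 1 - ⌈a⌉) 0 : ℤ) : ℝ) := by
    rw [← Int.toNat_eq_max]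
    norm_cast
  rw [h2]
  push_cast
  refine max_le ?_ (by linarith)
  have := Int.floor_le b
  have := Int.le_ceil a
  linarith

theorem polarizationMeasure_one_sub (α z : ℝ) :
    polarizationMeasure α (1 - z) = polarizationMeasure α z := by
  unfold polarizationMeasure
  rw [sub_sub_cancel, mul_comm]

theorem polarizationMeasure_le_rpow {α z : ℝ} (hα : 0 ≤ α) (h0 : 0 ≤ z) (h1 : z ≤ 1) :
    polarizationMeasure α z ≤ z ^ α := by
  unfold polarizationMeasure
  exact mul_le_of_le_one_right (Real.rpow_nonneg h0 α)
    (Real.rpow_le_one (by linarith) (by linarith) hα)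

theorem half_mul_le_polarizationMeasure {α z : ℝ} (hα : 0 ≤ α) (hα1 : α ≤ 1) (h0 : 0 ≤ z)
    (h1 : z ≤ 1 / 2) : 1 / 2 * z ^ α ≤ polarizationMeasure α z := by
  unfold polarizationMeasure
  rw [mul_comm]
  refine mul_le_mul_of_nonneg_left ?_ (Real.rpow_nonneg h0 α)
  calc (1 : ℝ) / 2 = (1 / 2) ^ (1 : ℝ) := by rw [Real.rpow_one]
    _ ≤ (1 / 2) ^ α := Real.rpow_le_rpow_of_exponent_ge (by norm_num) (by norm_num) hα1
    _ ≤ (1 - z) ^ α := Real.rpow_le_rpow (by norm_num) (by linarith) hα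

theorem exp_neg_logb_sq_rpow_le {α : ℝ} {l : ℕ} (h : IsLarge α l) :
    Real.exp (-Real.logb 2 (l : ℝ) ^ 2) ^ α ≤ 1 / l := by
  have hm := h.le_logb
  have hmα := h.mul_logb_le
  have hlm := h.rpow_logb
  set m := Real.logb 2 (l : ℝ)
  rw [← Real.exp_mul, one_div, ← hlm, Real.rpow_def_of_pos (by norm_num), ← Real.exp_neg,
    Real.exp_le_exp]
  have := Real.log_two_lt_d9
  nlinarith

/-- Bits far from the threshold are almost completely polarized; the others are few. -/
theorem sum_polarizationMeasure_le {α : ℝ} {l : ℕ} (h : IsLarge α l)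
    {K : Matrix (Fin l) (Fin l) (ZMod 2)} (hK : IsTypical K) {z : ℝ} (hz0 : 0 ≤ z) (hz1 : z ≤ 1) :
    ∑ i : Fin l, polarizationMeasure α (polarizationBehavior K i z) ≤
      7 * Real.logb 2 (l : ℝ) * √(l : ℝ) := by
  have hα := h.pos
  have hl0 := h.natCast_pos
  have hm := h.le_logb
  have hms := h.two_mul_logb_le_sqrt
  have hexp := exp_neg_logb_sq_rpow_le h
  set m := Real.logb 2 (l : ℝ) with hmdef
  -- The -1 makes i ≤ a the same as l - 1 - i ≥ l(1 - z) + 3m√l, the Chernoff condition for the dual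
  -- count.
  set a := l * z - 3 * m * √(l : ℝ) - 1 with ha
  set b := l * z + 3 * m * √(l : ℝ) with hb
  have hpt : ∀ i : Fin l, polarizationMeasure α (polarizationBehavior K i z) ≤
      1 / l + if a < (i : ℕ) ∧ ((i : ℕ) : ℝ) < b then 1 else 0 := by
    intro i
    rw [polarizationBehavior_eq]
    have hf0 := erasureWeight_nonneg (IsErased K i) hz0 hz1
    have hf1 := one_sub_erasureWeight (IsErased K i) z
    have hf2 := erasureWeight_nonneg (fun S => ¬ IsErased K i Sᶜ) (z := 1 - z) (by linarith)
      (by linarith)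
    have hinv : 0 ≤ 1 / (l : ℝ) := by positivity
    have hile : (i : ℕ) ≤ l - 1 := by have := i.2; omega
    have hl1 : 1 ≤ l := by have := i.2; omega
    split_ifs with hi
    · have h1 := polarizationMeasure_le_rpow hα.le hf0 (by linarith)
      have h2 := Real.rpow_le_one hf0 (by linarith : erasureWeight (IsErased K i) z ≤ 1) hα.le
      linarith
    · rw [add_zero]
      refine le_trans ?_ hexp
      rw [not_and_or, not_lt, not_lt] at hi
      rcases hi with hi | hi
      · rw [← polarizationMeasure_one_sub, hf1]
        refine (polarizationMeasure_le_rpow hα.le hf2 (by linarith)).trans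
          (Real.rpow_le_rpow hf2 ?_ hα.le)
        refine IsCountBounded.erasureWeight_le_exp h (j := l - 1 - i)
          (fun e he => (hK i e he).2) (by linarith) (by linarith) ?_
        rw [Nat.cast_sub hile, Nat.cast_sub hl1]
        push_cast
        linarith
      · refine (polarizationMeasure_le_rpow hα.le hf0 (by linarith)).trans
          (Real.rpow_le_rpow hf0 ?_ hα.le)
        exact IsCountBounded.erasureWeight_le_exp h (fun e he => (hK i e he).1) hz0 hz1 hi
  refine (Finset.sum_le_sum fun i _ => hpt i).trans ?_
  rw [Finset.sum_add_distrib, Finset.sum_boole]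
  have hms0 : 0 ≤ m * √(l : ℝ) := by positivity
  have hcard := card_mem_Ioo_le (l := l) (a := a) (b := b) (by linarith)
  have h1 : ∑ _i : Fin l, 1 / (l : ℝ) = 1 := by
    rw [Finset.sum_const, Finset.card_univ, Fintype.card_fin, nsmul_eq_mul]
    field_simp
  rw [h1]
  -- The far bits give 1 in total and the window at most b - a + 1 = 6m√l + 2; the excess 3 is below
  -- m√l.
  nlinarith

/-- The estimate for channels with a small parameter `z`, up to symmetry. -/
theorem sum_erasureWeight_rpow_le {α : ℝ} {l : ℕ} (h : IsLarge α l)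
    {Q : Fin l → Finset (Fin l) → Prop} {j : Fin l → ℕ} (hQ : ∀ i, IsCountBounded (Q i) (j i))
    (hQ0 : ∀ i, ¬ Q i ∅) {z : ℝ} (hz0 : 0 ≤ z) (hz1 : z ≤ 1 / (l : ℝ) ^ 2)
    (hj : ((Finset.univ.filter fun i => (j i : ℝ) < Real.logb 2 (l : ℝ) ^ 2).card : ℝ) ≤
      Real.logb 2 (l : ℝ) ^ 2 + 2) :
    ∑ i, erasureWeight (Q i) z ^ α ≤ 3 * ((l : ℝ) ^ α) ^ 3 * z ^ α := by
  have hl0 := h.natCast_pos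
  have hzα : 0 ≤ z ^ α := Real.rpow_nonneg hz0 α
  have hA0 : 0 ≤ (l : ℝ) ^ α := by positivity
  have hpt : ∀ i, erasureWeight (Q i) z ^ α ≤
      1 / l * z ^ α + (if (j i : ℝ) < Real.logb 2 (l : ℝ) ^ 2 then 1 else 0) *
        (2 * (l : ℝ) ^ α * z ^ α) := by
    intro i
    split_ifs with hi
    · have h1 := erasureWeight_rpow_le h (hQ0 i) hz0 hz1
      have h2 : 0 ≤ 1 / (l : ℝ) * z ^ α := by positivity
      linarith
    · rw [zero_mul, add_zero]
      exact (hQ i).erasureWeight_rpow_le_of_le h (hQ0 i) hz0 hz1 (not_lt.1 hi)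
  refine (Finset.sum_le_sum fun i _ => hpt i).trans ?_
  rw [Finset.sum_add_distrib, ← Finset.sum_mul, ← Finset.sum_mul, Finset.sum_boole]
  have h1 : ∑ _i : Fin l, 1 / (l : ℝ) = 1 := by
    rw [Finset.sum_const, Finset.card_univ, Fintype.card_fin, nsmul_eq_mul]
    field_simp
  rw [h1]
  have hA := h.le_rpow
  have hmA := h.logb_le_rpow
  have hm := h.le_logb
  set A := (l : ℝ) ^ α
  have h2 : Real.logb 2 (l : ℝ) ^ 2 ≤ A ^ 2 := by gcongr
  have h3 : 1 + (A ^ 2 + 2) * (2 * A) ≤ 3 * A ^ 3 := by nlinarith [sq_nonneg A]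
  calc 1 * z ^ α + _ * (2 * A * z ^ α)
      ≤ 1 * z ^ α + (A ^ 2 + 2) * (2 * A * z ^ α) := by
        gcongr
        linarith
    _ = (1 + (A ^ 2 + 2) * (2 * A)) * z ^ α := by ring
    _ ≤ _ := mul_le_mul_of_nonneg_right h3 hzα

/-- Nonsingularity enters here: it removes the term `e = 0`, so that f vanishes linearly at z = 0.
-/
theorem not_isErased_empty {l : ℕ} (K : Matrix.GeneralLinearGroup (Fin l) (ZMod 2)) (i : Fin l) :
    ¬ IsErased (K : Matrix (Fin l) (Fin l) (ZMod 2)) i ∅ := by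
  rintro ⟨u, hui, -, hu⟩
  have h1 : u ᵥ* (K : Matrix (Fin l) (Fin l) (ZMod 2)) = 0 := funext fun j => hu j (by simp)
  have h2 : u = 0 := Matrix.vecMul_injective_of_isUnit K.isUnit (by simpa using h1)
  rw [h2] at hui
  simp at hui

theorem isErased_univ {l : ℕ} (K : Matrix (Fin l) (Fin l) (ZMod 2)) (i : Fin l) :
    IsErased K i Finset.univ :=
  ⟨Pi.single i 1, by simp, fun j hj => by simp [hj.ne], fun j hj => by simp at hj⟩

theorem card_natCast_lt_le {l : ℕ} {x : ℝ} (hx : 0 ≤ x) :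
    ((Finset.univ.filter fun i : Fin l => ((i : ℕ) : ℝ) < x).card : ℝ) ≤ x + 2 := by
  refine le_trans (Nat.cast_le.2 (Finset.card_le_card fun i hi => ?_))
    ((card_mem_Ioo_le (l := l) (a := -1) (b := x) (by linarith)).trans (by linarith))
  simp only [Finset.mem_filter, Finset.mem_univ, true_and] at hi ⊢
  have : (0 : ℝ) ≤ ((i : ℕ) : ℝ) := Nat.cast_nonneg _
  exact ⟨by linarith, hi⟩

theorem card_natCast_rev_lt_le {l : ℕ} {x : ℝ} (hx : 0 ≤ x) :
    ((Finset.univ.filter fun i : Fin l => ((l - 1 - (i : ℕ) : ℕ) : ℝ) < x).card : ℝ) ≤ x + 2 := by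
  refine le_trans (Nat.cast_le.2 (le_of_eq ?_)) (card_natCast_lt_le (l := l) hx)
  refine Finset.card_equiv Fin.revPerm fun i => ?_
  have : l - 1 - (i : ℕ) = l - ((i : ℕ) + 1) := by omega
  simp [Fin.val_rev, this]

theorem sum_polarizationMeasure_le_of_le {α : ℝ} {l : ℕ} (h : IsLarge α l)
    {K : Matrix.GeneralLinearGroup (Fin l) (ZMod 2)}
    (hK : IsTypical (K : Matrix (Fin l) (Fin l) (ZMod 2))) {z : ℝ} (hz0 : 0 ≤ z)
    (hz1 : z ≤ 1 / (l : ℝ) ^ 2) :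
    ∑ i : Fin l, polarizationMeasure α
      (polarizationBehavior (K : Matrix (Fin l) (Fin l) (ZMod 2)) i z) ≤
      3 * ((l : ℝ) ^ α) ^ 3 * z ^ α := by
  have hz1' : z ≤ 1 := hz1.trans (div_le_one_of_le₀ (one_le_pow₀ h.one_le_natCast) (by positivity))
  refine le_trans (Finset.sum_le_sum fun i _ => ?_)
    (sum_erasureWeight_rpow_le h (fun i e he => (hK i e he).1) (not_isErased_empty K) hz0 hz1
      (card_natCast_lt_le (sq_nonneg _)))
  rw [polarizationBehavior_eq]
  have hf2 := erasureWeight_nonneg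
    (fun S => ¬ IsErased (K : Matrix (Fin l) (Fin l) (ZMod 2)) i Sᶜ) (z := 1 - z) (by linarith)
      (by linarith)
  rw [← one_sub_erasureWeight] at hf2
  exact polarizationMeasure_le_rpow h.pos.le (erasureWeight_nonneg _ hz0 hz1') (by linarith)

theorem sum_polarizationMeasure_le_of_one_sub_le {α : ℝ} {l : ℕ} (h : IsLarge α l)
    {K : Matrix (Fin l) (Fin l) (ZMod 2)} (hK : IsTypical K) {z : ℝ} (hz0 : 0 ≤ 1 - z)
    (hz1 : 1 - z ≤ 1 / (l : ℝ) ^ 2) :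
    ∑ i : Fin l, polarizationMeasure α (polarizationBehavior K i z) ≤
      3 * ((l : ℝ) ^ α) ^ 3 * (1 - z) ^ α := by
  have hz1' : 1 - z ≤ 1 :=
    hz1.trans (div_le_one_of_le₀ (one_le_pow₀ h.one_le_natCast) (by positivity))
  refine le_trans (Finset.sum_le_sum fun i _ => ?_)
    (sum_erasureWeight_rpow_le h (fun i e he => (hK i e he).2)
      (fun i hi => hi (by simpa using isErased_univ K i)) hz0 hz1
      (card_natCast_rev_lt_le (sq_nonneg _)))
  rw [polarizationBehavior_eq, ← polarizationMeasure_one_sub]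
  have hf2 := erasureWeight_nonneg (IsErased K i) (z := z) (by linarith) (by linarith)
  have hf0 := erasureWeight_nonneg (fun S => ¬ IsErased K i Sᶜ) hz0 hz1'
  rw [← one_sub_erasureWeight] at hf0 ⊢
  exact polarizationMeasure_le_rpow h.pos.le hf0 (by linarith)

/-! ### Bounds on λ -/

theorem lam_lt_of_mem_Icc {α : ℝ} {l : ℕ} (h : IsLarge α l)
    {K : Matrix (Fin l) (Fin l) (ZMod 2)} (hK : IsTypical K) {z : ℝ}
    (hz : z ∈ Set.Icc (1 / (l : ℝ) ^ 2) (1 - 1 / (l : ℝ) ^ 2)) :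
    lam α K z < (l : ℝ) ^ (-(1 / 2 : ℝ) + 5 * α) := by
  have hα := h.pos
  have hα1 := h.lt
  have hl0 := h.natCast_pos
  have hl1 := h.one_le_natCast
  have hA := h.le_rpow
  have hmA := h.logb_le_rpow
  have hm := h.le_logb
  have hms := h.two_mul_logb_le_sqrt
  have hss := Real.mul_self_sqrt hl0.le
  have hs0 : 0 < √(l : ℝ) := Real.sqrt_pos.2 hl0
  set s := √(l : ℝ)
  set a := 1 / (l : ℝ) ^ 2 with ha
  have ha0 : 0 < a := by positivity
  have ha1 : a ≤ 1 / 2 := by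
    rw [ha]
    refine one_div_le_one_div_of_le (by norm_num) ?_
    nlinarith
  have hsum := sum_polarizationMeasure_le h hK (z := z) (by linarith [hz.1]) (by linarith [hz.2])
  -- On the interval z(1 - z) is smallest at the endpoints.
  have hzz : a * (1 - a) ≤ z * (1 - z) := by nlinarith [hz.1, hz.2]
  have hg : 1 / (2 * ((l : ℝ) ^ α) ^ 2) ≤ polarizationMeasure α z := by
    have h1 := half_mul_le_polarizationMeasure hα.le (by linarith) ha0.le ha1
    have h2 : a ^ α = 1 / ((l : ℝ) ^ α) ^ 2 := by
      rw [ha, Real.div_rpow (by norm_num) (by positivity), Real.one_rpow, ← Real.rpow_natCast,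
        ← Real.rpow_natCast, ← Real.rpow_mul hl0.le, ← Real.rpow_mul hl0.le, mul_comm α]
    have h3 : polarizationMeasure α a ≤ polarizationMeasure α z := by
      unfold polarizationMeasure
      rw [← Real.mul_rpow (by linarith) (by linarith), ← Real.mul_rpow (by linarith [hz.1])
        (by linarith [hz.2])]
      exact Real.rpow_le_rpow (mul_nonneg (by linarith) (by linarith)) hzz hα.le
    rw [h2] at h1
    refine le_trans (le_of_eq ?_) (h1.trans h3)
    field_simp
  have hgoal : (l : ℝ) ^ (-(1 / 2 : ℝ) + 5 * α) = ((l : ℝ) ^ α) ^ 5 / s := by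
    rw [Real.rpow_add hl0, Real.rpow_neg hl0.le, ← Real.sqrt_eq_rpow, mul_comm 5 α,
      Real.rpow_mul hl0.le]
    norm_cast
    rw [inv_mul_eq_div]
  rw [hgoal, lam]
  set A := (l : ℝ) ^ α
  have hA0 : 0 < A := by linarith
  have hg0 : 0 < polarizationMeasure α z := lt_of_lt_of_le (by positivity) hg
  rw [div_lt_iff₀ hg0]
  calc 1 / (l : ℝ) * ∑ i : Fin l, polarizationMeasure α (polarizationBehavior K i z)
      ≤ 1 / (l : ℝ) * (7 * A * s) := by
        refine mul_le_mul_of_nonneg_left (hsum.trans ?_) (by positivity)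
        gcongr
    _ = 7 * A / s := by
        rw [← hss]
        field_simp
    _ < A ^ 5 / s * (1 / (2 * A ^ 2)) := by
        rw [div_mul_div_comm, div_lt_div_iff₀ hs0 (by positivity)]
        -- The numerator 7A and the bound 1/(2A²) for g_α combine to 14A³; A ≥ 64 leaves ample room.
        have h5 : 14 * A ^ 3 < A ^ 5 := by
          have : 14 < A ^ 2 := by nlinarith
          have h6 : 0 < A ^ 3 := by positivity
          nlinarith
        nlinarith
    _ ≤ _ := mul_le_mul_of_nonneg_left hg (by positivity)

/-- Here `w` stands for whichever of z and 1 - z is near 0. The ratio is at most 6A³/l, and 6A³ <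
A^4 ≤ A^8 ≤ √l. -/
theorem lam_lt_of_sum_le {α : ℝ} {l : ℕ} (h : IsLarge α l)
    {K : Matrix (Fin l) (Fin l) (ZMod 2)} {z w : ℝ} (hw0 : 0 < w) (hw1 : w ≤ 1 / 2)
    (hzw : polarizationMeasure α z = polarizationMeasure α w)
    (hsum : ∑ i : Fin l, polarizationMeasure α (polarizationBehavior K i z) ≤
      3 * ((l : ℝ) ^ α) ^ 3 * w ^ α) :
    lam α K z < (l : ℝ) ^ (-(1 / 2 : ℝ)) := by
  have hα := h.pos
  have hα1 := h.lt
  have hl0 := h.natCast_pos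
  have hA := h.le_rpow
  have hAs := h.rpow_pow_le_sqrt
  have hss := Real.mul_self_sqrt hl0.le
  have hs0 : 0 < √(l : ℝ) := Real.sqrt_pos.2 hl0
  have hg := half_mul_le_polarizationMeasure hα.le (by linarith) hw0.le hw1
  have hwα : 0 < w ^ α := Real.rpow_pos_of_pos hw0 α
  rw [← hzw] at hg
  have hg0 : 0 < polarizationMeasure α z := lt_of_lt_of_le (by positivity) hg
  rw [lam, Real.rpow_neg hl0.le, ← Real.sqrt_eq_rpow, div_lt_iff₀ hg0]
  set s := √(l : ℝ)
  set A := (l : ℝ) ^ α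
  have h1 : 6 * A ^ 3 < s := by
    refine lt_of_lt_of_le ?_ hAs
    have h2 : A ^ 4 ≤ A ^ 8 := pow_le_pow_right₀ (by linarith) (by norm_num)
    have h3 : 0 < A ^ 3 := by positivity
    nlinarith
  calc 1 / (l : ℝ) * ∑ i : Fin l, polarizationMeasure α (polarizationBehavior K i z)
      ≤ 1 / (l : ℝ) * (3 * A ^ 3 * w ^ α) := mul_le_mul_of_nonneg_left hsum (by positivity)
    _ = s⁻¹ * (1 / 2 * w ^ α) * (6 * A ^ 3 / s) := by
        rw [← hss]
        field_simp
        norm_num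
    _ < s⁻¹ * (1 / 2 * w ^ α) :=
        mul_lt_of_lt_one_right (by positivity) ((div_lt_one hs0).2 h1)
    _ ≤ _ := mul_le_mul_of_nonneg_left hg (by positivity)

theorem lam_lt_of_mem_Ioo {α : ℝ} {l : ℕ} (h : IsLarge α l)
    {K : Matrix.GeneralLinearGroup (Fin l) (ZMod 2)}
    (hK : IsTypical (K : Matrix (Fin l) (Fin l) (ZMod 2))) {z : ℝ}
    (hz : z ∈ Set.Ioo (0 : ℝ) (1 / (l : ℝ) ^ 2) ∪ Set.Ioo (1 - 1 / (l : ℝ) ^ 2) 1) :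
    lam α (K : Matrix (Fin l) (Fin l) (ZMod 2)) z < (l : ℝ) ^ (-(1 / 2 : ℝ)) := by
  have ha1 : 1 / (l : ℝ) ^ 2 ≤ 1 / 2 := by
    have hm := h.le_logb
    have hms := h.two_mul_logb_le_sqrt
    have hss := Real.mul_self_sqrt h.natCast_pos.le
    have := h.one_le_natCast
    refine one_div_le_one_div_of_le (by norm_num) ?_
    nlinarith
  rcases hz with ⟨hz0, hz1⟩ | ⟨hz0, hz1⟩
  · exact lam_lt_of_sum_le h hz0 (hz1.le.trans ha1) rfl
      (sum_polarizationMeasure_le_of_le h hK hz0.le hz1.le)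
  · exact lam_lt_of_sum_le h (w := 1 - z) (by linarith) (by linarith)
      (polarizationMeasure_one_sub α z).symm
      (sum_polarizationMeasure_le_of_one_sub_le h hK (by linarith) (by linarith))

end PolarKernel

theorem theorem5 (α : ℝ) (hα₀ : 0 < α) (hα₁ : α < 1 / 16) (l : ℕ)
    (hl : PolarKernel.ellOne α ≤ l) :
    PolarKernel.kernelProb l
        {K | ∀ z ∈ Set.Icc (1 / (l : ℝ) ^ 2) (1 - 1 / (l : ℝ) ^ 2),
          PolarKernel.lam α (K : Matrix (Fin l) (Fin l) (ZMod 2)) z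
            < (l : ℝ) ^ (-(1 / 2 : ℝ) + 5 * α)} > 1 - 1 / (l : ℝ) ∧
      PolarKernel.kernelProb l
        {K | ∀ z ∈ Set.Ioo (0 : ℝ) (1 / (l : ℝ) ^ 2) ∪ Set.Ioo (1 - 1 / (l : ℝ) ^ 2) 1,
          PolarKernel.lam α (K : Matrix (Fin l) (Fin l) (ZMod 2)) z
            < (l : ℝ) ^ (-(1 / 2 : ℝ))} > 1 - 1 / (l : ℝ) := by
  have h := PolarKernel.isLarge_of_ellOne_le hα₀ hα₁ hl
  have hl3 : 3 ≤ l := (PolarKernel.ellOne_isLeast α).1.1.trans_le hl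
  have hK := PolarKernel.kernelProb_isTypical hl3
  exact ⟨hK.trans_le (PolarKernel.kernelProb_mono fun K hK z hz =>
      PolarKernel.lam_lt_of_mem_Icc h hK hz),
    hK.trans_le (PolarKernel.kernelProb_mono fun K hK z hz =>
      PolarKernel.lam_lt_of_mem_Ioo h hK hz)⟩
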